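/- Let $n,d,e,m\ge 0$ be integers. For integers $a,b$ let $M_{a,b}$ be the set of exponent vectors $\gamma\in\mathbb{N}^n$ with $a\le|\gamma|\le b$, and regard $\mathbb{P}^{\binom{n+m}{n}-1}$, with homogeneous coordinates $(c_\gamma)_{\gamma\in M_{0,m}}$, as the space of nonzero polynomials $T=\sum_{|\gamma|\le m}c_\gamma x^\gamma\in\mathbb{C}[x_1,\dots,x_n]$ of degree at most $m$, up to scaling. Let $$\psi:\ \mathbb{C}^{\binom{d+n}{n}-1}\times\mathbb{C}^{\binom{e+n}{n}-1}\to\mathbb{P}^{\binom{n+m}{n}-1},\qquad (P,Q)\mapsto T,$$ be the map that sends a pair of polynomials $P,Q$ in $n$ variables with $\deg P\le d$, $\deg Q\le e$ and $P(0)=Q(0)=1$ to the Taylor polynomial $T$ of order $m$ of $P/Q$ at the origin. The Taylor variety $\mathcal{T}^n_{d,e,m}$ is the Zariski closure of the image of $\psi$. For a polynomial $T$ as above, the reduced Padé matrix $\hat P_T$ has rows indexed by $\alpha\in M_{d+1,m}$ and columns indexed by $\beta\in M_{1,e}$; its entry in row $\alpha$ and column $\beta$ is $c_{\alpha-\beta}$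 if $\beta\le\alpha$ componentwise, and $0$ otherwise. "For generic $T$" means: for all $T$ in some dense Zariski open subset of $\mathcal{T}^n_{d,e,m}$. **Theorem.** There is an integer $r\ge 0$ such that $\operatorname{rank}\hat P_T=r$ for generic $T\in\mathcal{T}^n_{d,e,m}$. If $\binom{d+n}{n}-1+r<\binom{n+m}{n}$, then $$\dim\mathcal{T}^n_{d,e,m}=\binom{d+n}{n}-1+r,$$ and, equivalently, for generic $T\in\mathcal{T}^n_{d,e,m}$ the fiber $\psi^{-1}(T)$ has dimension $\dim\psi^{-1}(T)=\dim\ker\hat P_T$ (in particular it is nonempty). -/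

import Mathlib

namespace TaylorVar

noncomputable section

/-- The exponent vectors `γ` of the monomials `x^γ` in `n` variables with `a ≤ |γ| ≤ b`;
this is the set of monomials `M_{a,b}`. -/
abbrev Mon (n a b : ℕ) : Type :=
  {γ : Fin n →₀ ℕ // a ≤ γ.degree ∧ γ.degree ≤ b}

instance instFiniteMon (n a b : ℕ) : Finite (Mon n a b) :=
  Set.Finite.subset (Finsupp.finite_of_degree_le b) (fun _ h => h.2)

instance instFintypeMon (n a b : ℕ) : Fintype (Mon n a b) := Fintype.ofFinite _

/-! ### Affine and projective space over `ℂ` with the Zariski topology -/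

/-- Affine space over `ℂ` with coordinates indexed by `ι`. It is a new type, so that it carries
the Zariski topology and not the Euclidean product topology. -/
def AffSpace (ι : Type) : Type := ι → ℂ

/-- The Zariski topology on affine space: the sets `{f ≠ 0}`, for polynomials `f`, are a basis
of the open sets. -/
instance instZariskiAff (ι : Type) : TopologicalSpace (AffSpace ι) :=
  TopologicalSpace.generateFrom
    {U : Set (AffSpace ι) | ∃ f : MvPolynomial ι ℂ, U = {x | MvPolynomial.eval x f ≠ 0}}

/-- Projective space over `ℂ` with homogeneous coordinates indexed by `ι`. -/
def ProjSpace (ι : Type) : Type := Projectivization ℂ (ι → ℂ)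

/-- A vector of homogeneous coordinates of a point of projective space. -/
def ProjSpace.rep {ι : Type} (T : ProjSpace ι) : ι → ℂ := Projectivization.rep T

/-- The Zariski topology on projective space: the sets `{f ≠ 0}`, for homogeneous polynomials
`f`, are a basis of the open sets. -/
instance instZariskiProj (ι : Type) : TopologicalSpace (ProjSpace ι) :=
  TopologicalSpace.generateFrom
    {U : Set (ProjSpace ι) | ∃ (f : MvPolynomial ι ℂ) (k : ℕ), f.IsHomogeneous k ∧
      U = {T | MvPolynomial.eval T.rep f ≠ 0}}

/-- `p` holds at a generic point of `X`: it holds at all points of a dense, relatively open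
subset of `X`. -/
def Generically {Y : Type} [TopologicalSpace Y] (X : Set Y) (p : Y → Prop) : Prop :=
  ∃ U : Set Y, IsOpen U ∧ X ⊆ closure (X ∩ U) ∧ ∀ T ∈ X ∩ U, p T

/-! ### The parametrization and the Taylor variety -/

/-- The polynomial `1 + ∑ p_α x^α`, the sum over all `α` with `1 ≤ |α| ≤ d`. These are the
polynomials of degree at most `d` with constant term `1`. -/
def normPoly (n d : ℕ) (p : Mon n 1 d → ℂ) : MvPolynomial (Fin n) ℂ :=
  1 + ∑ α : Mon n 1 d, MvPolynomial.monomial α.1 (p α)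

/-- The coefficients `c_γ`, for `|γ| ≤ m`, of the Taylor series of `P / Q` at the origin. -/
def taylorCoeff (n m : ℕ) (P Q : MvPolynomial (Fin n) ℂ) : Mon n 0 m → ℂ :=
  fun γ => MvPowerSeries.coeff γ.1
    ((P : MvPowerSeries (Fin n) ℂ) * (Q : MvPowerSeries (Fin n) ℂ)⁻¹)

lemma constantCoeff_normPoly (n d : ℕ) (p : Mon n 1 d → ℂ) :
    MvPolynomial.constantCoeff (normPoly n d p) = 1 := by
  have h : ∀ α : Mon n 1 d, α.1 ≠ 0 := by
    rintro ⟨α, h1, -⟩ rfl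
    simp at h1
  simp [normPoly, MvPolynomial.constantCoeff_monomial, h]

lemma taylorCoeff_ne_zero (n m d e : ℕ) (p : Mon n 1 d → ℂ) (q : Mon n 1 e → ℂ) :
    taylorCoeff n m (normPoly n d p) (normPoly n e q) ≠ 0 := by
  intro h
  have h0 := congrFun h ⟨0, by simp⟩
  have hp := constantCoeff_normPoly n d p
  have hq := constantCoeff_normPoly n e q
  rw [MvPolynomial.constantCoeff_eq] at hp hq
  simp [taylorCoeff, MvPowerSeries.coeff_zero_eq_constantCoeff_apply] at h0
  simp [← MvPowerSeries.coeff_zero_eq_constantCoeff_apply, hp, hq] at h0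

/-- The parametrization `(P, Q) ↦ T`. It takes the coefficients of polynomials `P`, `Q` of
degrees at most `d`, `e` with `P(0) = Q(0) = 1` to the `m`-th Taylor polynomial of `P / Q`, which
is a point of the projective space of polynomials of degree at most `m`. -/
def taylorMap (n d e m : ℕ) (z : AffSpace (Mon n 1 d ⊕ Mon n 1 e)) :
    ProjSpace (Mon n 0 m) :=
  Projectivization.mk ℂ
    (taylorCoeff n m (normPoly n d fun α => z (Sum.inl α)) (normPoly n e fun β => z (Sum.inr β)))
    (taylorCoeff_ne_zero n m d e _ _)

/-- The Taylor variety: the Zariski closure in projective space of the set of Taylor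
polynomials. -/
def taylorVariety (n d e m : ℕ) : Set (ProjSpace (Mon n 0 m)) :=
  closure (Set.range (taylorMap n d e m))

/-! ### The Padé matrix -/

open Classical in
/-- The Padé matrix `P_T` of `T = ∑ c_γ x^γ`: its entry in row `α` and column `β` is
`c_{α - β}` if `β ≤ α`, and `0` otherwise. -/
def padeMatrix (n d e m : ℕ) (c : Mon n 0 m → ℂ) :
    Matrix (Mon n (d + 1) m) (Mon n 0 e) ℂ :=
  Matrix.of fun α β =>
    if β.1 ≤ α.1 then
      c ⟨α.1 - β.1, Nat.zero_le _, (Finsupp.degree_mono tsub_le_self).trans α.2.2⟩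
    else 0

/-- The reduced Padé matrix: the Padé matrix without its first column, which is the
column of the monomial `1`. -/
def reducedPadeMatrix (n d e m : ℕ) (c : Mon n 0 m → ℂ) :
    Matrix (Mon n (d + 1) m) (Mon n 1 e) ℂ :=
  (padeMatrix n d e m c).submatrix id (fun β => ⟨β.1, Nat.zero_le _, β.2.2⟩)

end

end TaylorVar

/-!
Let `x` be the coefficients of the numerator and denominator, taken as indeterminates over `ℂ`,
let `F = ℂ(x)`, and let `K` be the subfield generated by the Taylor coefficients of the quotient.
The number `r` is the rank of the reduced Padé matrix of these Taylor coefficients, a matrix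
over `K` (`genPadeMatrix`).

*Padé equations.* A polynomial with coefficients `c` and `c 0 = 1` is the Taylor polynomial of
`P / Q` if and only if the coefficients of `Q` solve an inhomogeneous linear system whose matrix
is the reduced Padé matrix of `c` and whose right-hand side is minus the first column of the full
Padé matrix, and `P` is the part of degree at most `d` of `Q` times the polynomial
(`coeff_quotSeries_eq_iff`). This needs `d ≤ m`, unless there are no variables, and the numerical
hypothesis implies it (`degree_le_of_choose_lt`).

*Dimension of the variety.* The dimension is the transcendence degree of `K`
(`topologicalKrullDim_closure_range_projMap`). This rests on the Nullstellensatz, on Noether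
normalization and on the standard charts of projective space. By the Padé equations, `F` is
generated over `K` by the solution `Q` of a linear system over `K`. Adding to `Q` a combination,
with new indeterminates as coefficients, of kernel vectors over `K` leaves the Taylor coefficients
fixed, and so extends to an embedding of `F` over `K` (`exists_shift`). Hence the coordinates
of `Q` along the kernel are a transcendence basis of `F` over `K`
(`trdeg_eq_card_sub_rank`), and the transcendence degree of `K` is the number of coefficients
of `P` plus `r` (`trdeg_genField_taylorPoly`).

*Generic rank.* A minor that vanishes on all Taylor polynomials vanishes on their closure, so that
the reduced matrix has rank at most `r` on the whole variety, and rank `r` where a suitable minor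
does not vanish; this open set is dense because the variety is irreducible
(`exists_isOpen_rank_eq`).

*Fibers.* On the image of the parametrization, the first column of the Padé matrix is a combination
of the others. So the minors of size larger than `r` of the full Padé matrix vanish on the variety
as well (`rank_padeMatrix_le`). Where the reduced matrix has rank `r` the linear system is therefore
consistent, and the fiber is an affine space of the dimension of the kernel
(`topologicalKrullDim_fiber`).
-/

namespace TaylorVar

/-! ### Affine space in the Zariski topology -/

noncomputable section AffineZariski

open MvPolynomial TopologicalSpace Topology

variable {ι κ : Type}

@[ext] theorem AffSpace.ext {x y : AffSpace ι} (h : ∀ i, x i = y i) : x = y :=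
  funext h

/-- The value of a polynomial at a point of affine space. -/
def evalAt (x : AffSpace ι) : MvPolynomial ι ℂ →+* ℂ := eval (fun i => (x i : ℂ))

@[simp] theorem evalAt_C (x : AffSpace ι) (a : ℂ) : evalAt x (C a) = a := eval_C a

@[simp] theorem evalAt_X (x : AffSpace ι) (i : ι) : evalAt x (X i) = x i := eval_X i

theorem isTopologicalBasis_affSpace (ι : Type) :
    IsTopologicalBasis
      {U : Set (AffSpace ι) | ∃ f : MvPolynomial ι ℂ, U = {x | evalAt x f ≠ 0}} := by
  have h := isTopologicalBasis_of_subbasis_of_inter (t := instZariskiAff ι)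
    (r := {U : Set (AffSpace ι) | ∃ f : MvPolynomial ι ℂ, U = {x | evalAt x f ≠ 0}}) rfl ?_
  · have huniv : (Set.univ : Set (AffSpace ι)) ∈
        {U : Set (AffSpace ι) | ∃ f : MvPolynomial ι ℂ, U = {x | evalAt x f ≠ 0}} :=
      ⟨1, by simp⟩
    rwa [Set.insert_eq_of_mem huniv] at h
  · rintro _ ⟨f, rfl⟩ _ ⟨g, rfl⟩
    refine ⟨f * g, ?_⟩
    ext x
    simp

theorem isOpen_evalAt_ne_zero (f : MvPolynomial ι ℂ) :
    IsOpen {x : AffSpace ι | evalAt x f ≠ 0} :=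
  isOpen_generateFrom_of_mem ⟨f, rfl⟩

theorem isClosed_evalAt_eq_zero (f : MvPolynomial ι ℂ) :
    IsClosed {x : AffSpace ι | evalAt x f = 0} := by
  rw [← isOpen_compl_iff]
  exact isOpen_evalAt_ne_zero f

/-- The common zeros in affine space of the polynomials in `I`. -/
def zeros (I : Ideal (MvPolynomial ι ℂ)) : Set (AffSpace ι) := {x | ∀ f ∈ I, evalAt x f = 0}

/-- The ideal of polynomials that vanish on a subset of affine space. -/
def idealOf (s : Set (AffSpace ι)) : Ideal (MvPolynomial ι ℂ) :=
  vanishingIdeal ℂ (K := ℂ) (σ := ι) s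

theorem mem_idealOf {s : Set (AffSpace ι)} {f : MvPolynomial ι ℂ} :
    f ∈ idealOf s ↔ ∀ x ∈ s, evalAt x f = 0 := Iff.rfl

theorem idealOf_anti {s t : Set (AffSpace ι)} (h : s ⊆ t) : idealOf t ≤ idealOf s :=
  fun _ hf x hx => hf x (h hx)

theorem zeros_anti {I J : Ideal (MvPolynomial ι ℂ)} (h : I ≤ J) : zeros J ⊆ zeros I :=
  fun _ hx f hf => hx f (h hf)

theorem idealOf_zeros [Finite ι] (P : Ideal (MvPolynomial ι ℂ)) [P.IsPrime] :
    idealOf (zeros P) = P :=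
  IsPrime.vanishingIdeal_zeroLocus (K := ℂ) P

theorem isClosed_zeros (I : Ideal (MvPolynomial ι ℂ)) : IsClosed (zeros I) := by
  have : zeros I = ⋂ f ∈ I, {x : AffSpace ι | evalAt x f = 0} := by
    ext x
    simp [zeros]
  rw [this]
  exact isClosed_biInter fun f _ => isClosed_evalAt_eq_zero f

theorem mem_closure_iff_evalAt (s : Set (AffSpace ι)) (x : AffSpace ι) :
    x ∈ closure s ↔ ∀ f : MvPolynomial ι ℂ, (∀ y ∈ s, evalAt y f = 0) → evalAt x f = 0 := by
  rw [(isTopologicalBasis_affSpace ι).mem_closure_iff]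
  constructor
  · intro h f hf
    by_contra hx
    obtain ⟨y, hy, hys⟩ := h _ ⟨f, rfl⟩ hx
    exact hy (hf y hys)
  · rintro h _ ⟨f, rfl⟩ hx
    by_contra hne
    refine hx (h f fun y hy => ?_)
    by_contra hy0
    exact hne ⟨y, hy0, hy⟩

/-- The map of affine spaces given by a family of polynomials. -/
def polyMap (t : ι → MvPolynomial κ ℂ) (z : AffSpace κ) : AffSpace ι :=
  fun i => evalAt z (t i)

theorem evalAt_polyMap (t : ι → MvPolynomial κ ℂ) (z : AffSpace κ) (f : MvPolynomial ι ℂ) :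
    evalAt (polyMap t z) f = evalAt z (aeval t f) := by
  induction f using MvPolynomial.induction_on with
  | C a => simp
  | add f g hf hg => simp [hf, hg]
  | mul_X f i hf => simp [hf, polyMap]

theorem continuous_polyMap (t : ι → MvPolynomial κ ℂ) : Continuous (polyMap t) := by
  refine (isTopologicalBasis_affSpace ι).continuous_iff.2 ?_
  rintro _ ⟨f, rfl⟩
  simp only [Set.preimage_ofPred_eq, evalAt_polyMap]
  exact isOpen_evalAt_ne_zero _

theorem exists_evalAt_ne_zero {f : MvPolynomial ι ℂ} (hf : f ≠ 0) :
    ∃ x : AffSpace ι, evalAt x f ≠ 0 := by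
  by_contra! h
  exact hf (MvPolynomial.funext fun x => (h x).trans (map_zero _).symm)

instance : IrreducibleSpace (AffSpace ι) where
  isPreirreducible_univ := by
    rintro U V hU hV ⟨x, -, hx⟩ ⟨y, -, hy⟩
    obtain ⟨_, ⟨f, rfl⟩, hfx, hfU⟩ :=
      (isTopologicalBasis_affSpace ι).exists_subset_of_mem_open hx hU
    obtain ⟨_, ⟨g, rfl⟩, hgy, hgV⟩ :=
      (isTopologicalBasis_affSpace ι).exists_subset_of_mem_open hy hV
    have hf : f ≠ 0 := by rintro rfl; exact hfx (map_zero _)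
    have hg : g ≠ 0 := by rintro rfl; exact hgy (map_zero _)
    obtain ⟨z, hz⟩ := exists_evalAt_ne_zero (mul_ne_zero hf hg)
    rw [map_mul] at hz
    exact ⟨z, trivial, hfU (left_ne_zero_of_mul hz), hgV (right_ne_zero_of_mul hz)⟩
  toNonempty := ⟨fun _ => 0⟩

/-- An irreducible set has a prime vanishing ideal. -/
theorem isPrime_idealOf {s : Set (AffSpace ι)} (hs : IsIrreducible s) :
    (idealOf s).IsPrime := by
  refine ⟨fun h => ?_, fun {f g} hfg => ?_⟩
  · obtain ⟨x, hx⟩ := hs.nonempty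
    have h1 : (1 : MvPolynomial ι ℂ) ∈ idealOf s := h ▸ Submodule.mem_top
    exact one_ne_zero ((map_one (evalAt x)).symm.trans (h1 x hx))
  · by_contra! hcon
    obtain ⟨hf, hg⟩ := hcon
    simp only [mem_idealOf, not_forall] at hf hg
    obtain ⟨x, hxs, hx⟩ := hf
    obtain ⟨y, hys, hy⟩ := hg
    obtain ⟨z, hzs, hzf, hzg⟩ := hs.isPreirreducible _ _ (isOpen_evalAt_ne_zero f)
      (isOpen_evalAt_ne_zero g) ⟨x, hxs, hx⟩ ⟨y, hys, hy⟩
    have := mem_idealOf.1 hfg z hzs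
    rw [map_mul] at this
    exact (mul_ne_zero hzf hzg) this

theorem isIrreducible_zeros [Finite ι] (P : Ideal (MvPolynomial ι ℂ)) [hP : P.IsPrime] :
    IsIrreducible (zeros P) := by
  have hv : idealOf (zeros P) = P := idealOf_zeros P
  constructor
  · by_contra h
    rw [Set.not_nonempty_iff_eq_empty] at h
    rw [h] at hv
    exact hP.ne_top (hv.symm.trans vanishingIdeal_empty)
  · rintro U V hU hV ⟨x, hxs, hx⟩ ⟨y, hys, hy⟩
    obtain ⟨_, ⟨f, rfl⟩, hfx, hfU⟩ :=
      (isTopologicalBasis_affSpace ι).exists_subset_of_mem_open hx hU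
    obtain ⟨_, ⟨g, rfl⟩, hgy, hgV⟩ :=
      (isTopologicalBasis_affSpace ι).exists_subset_of_mem_open hy hV
    have hf : f ∉ P := fun h => hfx (hxs f h)
    have hg : g ∉ P := fun h => hgy (hys g h)
    have hfg : f * g ∉ P := fun h => (hP.mem_or_mem h).elim hf hg
    rw [← hv] at hfg
    simp only [mem_idealOf, not_forall] at hfg
    obtain ⟨z, hz, hzfg⟩ := hfg
    rw [map_mul] at hzfg
    exact ⟨z, hz, hfU (left_ne_zero_of_mul hzfg), hgV (right_ne_zero_of_mul hzfg)⟩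

theorem le_of_zeros_subset [Finite ι] {P Q : Ideal (MvPolynomial ι ℂ)} [P.IsPrime] [Q.IsPrime]
    (h : zeros P ⊆ zeros Q) : Q ≤ P :=
  (idealOf_zeros Q).symm.le.trans ((idealOf_anti h).trans (idealOf_zeros P).le)

/-- By the Nullstellensatz, irreducible closed subsets of the zero locus of `I` correspond to
primes containing `I`. -/
theorem topologicalKrullDim_zeros [Finite ι] (I : Ideal (MvPolynomial ι ℂ)) :
    topologicalKrullDim (zeros I) = ringKrullDim (MvPolynomial ι ℂ ⧸ I) := by
  rw [ringKrullDim_quotient, topologicalKrullDim,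
    ← Order.krullDim_orderDual (α := PrimeSpectrum.zeroLocus _)]
  apply le_antisymm
  · let F : IrreducibleCloseds (zeros I) →
        (PrimeSpectrum.zeroLocus (I : Set (MvPolynomial ι ℂ)))ᵒᵈ := fun C =>
      OrderDual.toDual ⟨⟨idealOf (Subtype.val '' (C : Set (zeros I))),
        isPrime_idealOf (C.isIrreducible.image _ continuous_subtype_val.continuousOn)⟩, by
        rintro f hf _ ⟨x, -, rfl⟩
        exact x.2 f hf⟩
    have key : ∀ C D, F C ≤ F D → C ≤ D := by
      intro C D h x hx
      have h' : idealOf (Subtype.val '' (D : Set (zeros I))) ≤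
        idealOf (Subtype.val '' (C : Set (zeros I))) := h
      have : x ∈ closure (D : Set (zeros I)) := by
        rw [closure_subtype, mem_closure_iff_evalAt]
        intro f hf
        exact h' hf _ ⟨x, hx, rfl⟩
      rwa [D.isClosed.closure_eq] at this
    have hmono : Monotone F := fun C D h => idealOf_anti (Set.image_mono h)
    refine Order.krullDim_le_of_strictMono F (hmono.strictMono_of_injective fun C D h => ?_)
    exact le_antisymm (key _ _ h.le) (key _ _ h.ge)
  · let G : (PrimeSpectrum.zeroLocus (I : Set (MvPolynomial ι ℂ)))ᵒᵈ →
        IrreducibleCloseds (zeros I) := fun P =>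
      { carrier := Subtype.val ⁻¹' zeros (OrderDual.ofDual P).1.asIdeal
        isIrreducible' := by
          have hP := (OrderDual.ofDual P).1.isPrime
          have hsub : zeros (OrderDual.ofDual P).1.asIdeal ⊆ zeros I :=
            zeros_anti (OrderDual.ofDual P).2
          have := isIrreducible_zeros (OrderDual.ofDual P).1.asIdeal
          refine ⟨?_, ?_⟩
          · obtain ⟨x, hx⟩ := this.nonempty
            exact ⟨⟨x, hsub hx⟩, hx⟩
          · rintro _ _ ⟨U, hU, rfl⟩ ⟨V, hV, rfl⟩ ⟨x, hx, hxU⟩ ⟨y, hy, hyV⟩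
            obtain ⟨z, hz, hzU, hzV⟩ :=
              this.isPreirreducible U V hU hV ⟨x, hx, hxU⟩ ⟨y, hy, hyV⟩
            exact ⟨⟨z, hsub hz⟩, hz, hzU, hzV⟩
        isClosed' := (isClosed_zeros _).preimage continuous_subtype_val }
    have hmem : ∀ P (x : zeros I),
        x ∈ G P ↔ (x : AffSpace ι) ∈ zeros (OrderDual.ofDual P).1.asIdeal := fun _ _ => Iff.rfl
    have hG : ∀ P Q, G P ≤ G Q → P ≤ Q := by
      intro P Q h
      have h1 := (OrderDual.ofDual P).1.isPrime
      have h2 := (OrderDual.ofDual Q).1.isPrime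
      have hPI : I ≤ (OrderDual.ofDual P).1.asIdeal := (OrderDual.ofDual P).2
      have hle : (OrderDual.ofDual Q).1.asIdeal ≤ (OrderDual.ofDual P).1.asIdeal :=
        le_of_zeros_subset fun x hx =>
          (hmem Q ⟨x, zeros_anti hPI hx⟩).1 (h ((hmem P ⟨x, zeros_anti hPI hx⟩).2 hx))
      exact hle
    have hmono : Monotone G := fun P Q h x hx =>
      zeros_anti (show (OrderDual.ofDual Q).1.asIdeal ≤ (OrderDual.ofDual P).1.asIdeal from h) hx
    refine Order.krullDim_le_of_strictMono G (hmono.strictMono_of_injective fun C D h => ?_)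
    exact le_antisymm (hG _ _ h.le) (hG _ _ h.ge)

theorem topologicalKrullDim_affSpace [Finite ι] :
    topologicalKrullDim (AffSpace ι) = (Nat.card ι : WithBot ℕ∞) := by
  have h := topologicalKrullDim_zeros (ι := ι) ⊥
  rw [ringKrullDim_eq_of_ringEquiv (RingEquiv.quotientBot _),
    MvPolynomial.ringKrullDim_of_isNoetherianRing, ringKrullDim_eq_zero_of_field, zero_add] at h
  rw [← h]
  let e : AffSpace ι ≃ₜ zeros (⊥ : Ideal (MvPolynomial ι ℂ)) :=
    (Homeomorph.Set.univ _).symm.trans (Homeomorph.setCongr (by ext x; simp [zeros]))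
  exact IsHomeomorph.topologicalKrullDim_eq e e.isHomeomorph

end AffineZariski

/-! ### Krull dimension and transcendence degree -/

section KrullDimTrdeg

/-- Primes of `S` in a chain have different contractions, and conversely chains of primes of `R`
lift by lying over and going up. -/
theorem ringKrullDim_eq_of_isIntegral {R S : Type*} [CommRing R] [CommRing S] [Algebra R S]
    [Algebra.IsIntegral R S] [FaithfulSMul R S] : ringKrullDim S = ringKrullDim R := by
  apply le_antisymm
  · refine Order.krullDim_le_of_strictMono (PrimeSpectrum.comap (algebraMap R S)) ?_
    intro P Q h
    exact Ideal.IsIntegral.comap_lt_comap (I := P.asIdeal) h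
  · refine iSup_le fun l => ?_
    have hp := l.head.isPrime
    obtain ⟨P, -, hP, hPl⟩ := Ideal.exists_ideal_over_prime_of_isIntegral (S := S)
      l.head.asIdeal ⊥ (by
      intro x hx
      have : x = 0 := by
        apply FaithfulSMul.algebraMap_injective R S
        simpa using hx
      simp [this])
    have : P.LiesOver l.head.asIdeal := ⟨hPl.symm⟩
    obtain ⟨L, hL, -⟩ := Ideal.exists_ltSeries_of_hasGoingUp (S := S) l P
    exact le_iSup_of_le L (by simp [hL])

/-- By Noether normalization, the dimension of an affine domain is its transcendence degree. -/
theorem ringKrullDim_eq_trdeg (k A : Type) [Field k] [CommRing A] [IsDomain A] [Algebra k A]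
    [Algebra.FiniteType k A] :
    ringKrullDim A = ((Cardinal.toNat (Algebra.trdeg k A) : ℕ) : WithBot ℕ∞) := by
  obtain ⟨s, g, hg, hint⟩ := exists_integral_inj_algHom_of_fg k A
  algebraize [g.toRingHom]
  have : FaithfulSMul (MvPolynomial (Fin s) k) A := by
    rw [faithfulSMul_iff_algebraMap_injective]
    exact hg
  have : Algebra.IsIntegral (MvPolynomial (Fin s) k) A := ⟨hint⟩
  have : IsScalarTower k (MvPolynomial (Fin s) k) A :=
    .of_algebraMap_eq fun x => (g.commutes x).symm
  have h0 : Algebra.trdeg (MvPolynomial (Fin s) k) A = 0 := trdeg_eq_zero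
  rw [ringKrullDim_eq_of_isIntegral (R := MvPolynomial (Fin s) k),
    ← trdeg_add_eq k (MvPolynomial (Fin s) k) (A := A), h0,
    MvPolynomial.ringKrullDim_of_isNoetherianRing, ringKrullDim_eq_zero_of_field]
  simp

end KrullDimTrdeg

/-! ### Projective space and its affine charts -/

noncomputable section Projective

open MvPolynomial TopologicalSpace Topology

variable {ι κ : Type}

/-- The origin of affine space. -/
instance : Zero (AffSpace ι) := ⟨fun _ => (0 : ℂ)⟩

/-- The homogeneous coordinates of a point of projective space, as a point of affine space. -/
def hcoord (T : ProjSpace ι) : AffSpace ι := T.rep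

/-- The point of projective space with given homogeneous coordinates. -/
def ofCoord (x : AffSpace ι) (hx : x ≠ 0) : ProjSpace ι := Projectivization.mk ℂ (V := ι → ℂ) x hx

theorem isTopologicalBasis_projSpace (ι : Type) :
    IsTopologicalBasis
      {U : Set (ProjSpace ι) | ∃ (f : MvPolynomial ι ℂ) (k : ℕ), f.IsHomogeneous k ∧
        U = {T | evalAt (hcoord T) f ≠ 0}} := by
  have h := isTopologicalBasis_of_subbasis_of_inter (t := instZariskiProj ι)
    (r := {U : Set (ProjSpace ι) | ∃ (f : MvPolynomial ι ℂ) (k : ℕ), f.IsHomogeneous k ∧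
        U = {T | evalAt (hcoord T) f ≠ 0}}) rfl ?_
  · have huniv : (Set.univ : Set (ProjSpace ι)) ∈
        {U : Set (ProjSpace ι) | ∃ (f : MvPolynomial ι ℂ) (k : ℕ), f.IsHomogeneous k ∧
          U = {T | evalAt (hcoord T) f ≠ 0}} :=
      ⟨1, 0, isHomogeneous_one _ _, by simp⟩
    rwa [Set.insert_eq_of_mem huniv] at h
  · rintro _ ⟨f, k, hf, rfl⟩ _ ⟨g, l, hg, rfl⟩
    refine ⟨f * g, k + l, hf.mul hg, ?_⟩
    ext x
    simp

theorem isOpen_evalAt_hcoord_ne_zero {f : MvPolynomial ι ℂ} {k : ℕ} (hf : f.IsHomogeneous k) :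
    IsOpen {T : ProjSpace ι | evalAt (hcoord T) f ≠ 0} :=
  isOpen_generateFrom_of_mem ⟨f, k, hf, rfl⟩

theorem aeval_mul_of_isHomogeneous {B : Type} [CommRing B] [Algebra ℂ B]
    {f : MvPolynomial ι ℂ} {k : ℕ} (hf : f.IsHomogeneous k) (a : B) (x : ι → B) :
    aeval (fun i => a * x i) f = a ^ k * aeval x f := by
  simp only [aeval_def, eval₂_eq, Finset.mul_sum]
  refine Finset.sum_congr rfl fun d hd => ?_
  have hdk : d.degree = k := by
    have := hf (mem_support_iff.1 hd)
    rwa [Finsupp.degree_eq_weight_one]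
  rw [← hdk, Finsupp.degree_apply]
  simp only [mul_pow, Finset.prod_mul_distrib, Finset.prod_pow_eq_pow_sum]
  ring

theorem evalAt_mul_of_isHomogeneous {f : MvPolynomial ι ℂ} {k : ℕ} (hf : f.IsHomogeneous k)
    (a : ℂ) (x : AffSpace ι) :
    evalAt (fun i => a * x i : AffSpace ι) f = a ^ k * evalAt x f :=
  aeval_mul_of_isHomogeneous hf a fun i => (x i : ℂ)

theorem exists_hcoord_ofCoord (x : AffSpace ι) (hx : x ≠ 0) :
    ∃ a : ℂ, a ≠ 0 ∧ hcoord (ofCoord x hx) = fun i => a * x i := by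
  obtain ⟨a, ha⟩ := Projectivization.exists_smul_eq_mk_rep ℂ (V := ι → ℂ) x hx
  exact ⟨a, a.ne_zero, ha.symm⟩

theorem evalAt_hcoord_ofCoord_ne_zero_iff {f : MvPolynomial ι ℂ} {k : ℕ}
    (hf : f.IsHomogeneous k) (x : AffSpace ι) (hx : x ≠ 0) :
    evalAt (hcoord (ofCoord x hx)) f ≠ 0 ↔ evalAt x f ≠ 0 := by
  obtain ⟨a, ha, h⟩ := exists_hcoord_ofCoord x hx
  rw [h, evalAt_mul_of_isHomogeneous hf]
  simp [ha]

theorem hcoord_ne_zero (T : ProjSpace ι) : hcoord T ≠ 0 :=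
  Projectivization.rep_nonzero T

theorem ofCoord_eq_iff (x y : AffSpace ι) (hx : x ≠ 0) (hy : y ≠ 0) :
    ofCoord x hx = ofCoord y hy ↔ ∃ a : ℂ, x = fun i => a * y i := by
  refine (Projectivization.mk_eq_mk_iff' ℂ (V := ι → ℂ) x y hx hy).trans ?_
  exact ⟨fun ⟨a, ha⟩ => ⟨a, ha.symm⟩, fun ⟨a, ha⟩ => ⟨a, ha.symm⟩⟩

theorem ofCoord_hcoord (T : ProjSpace ι) : ofCoord (hcoord T) (hcoord_ne_zero T) = T :=
  Projectivization.mk_rep T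

/-- The map to projective space with homogeneous coordinates given by polynomials. -/
def projMap (t : ι → MvPolynomial κ ℂ) (ht : ∀ z, polyMap t z ≠ 0) (z : AffSpace κ) :
    ProjSpace ι :=
  ofCoord (polyMap t z) (ht z)

theorem continuous_projMap (t : ι → MvPolynomial κ ℂ) (ht : ∀ z, polyMap t z ≠ 0) :
    Continuous (projMap t ht) := by
  refine (isTopologicalBasis_projSpace ι).continuous_iff.2 ?_
  rintro _ ⟨f, k, hf, rfl⟩
  simp only [Set.preimage_ofPred_eq, projMap, evalAt_hcoord_ofCoord_ne_zero_iff hf,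
    evalAt_polyMap]
  exact isOpen_evalAt_ne_zero _

/-- The homogenization of `f` with respect to the variable `X i`. -/
def homog (i : ι) (f : MvPolynomial ι ℂ) : MvPolynomial ι ℂ :=
  ∑ k ∈ Finset.range (f.totalDegree + 1), X i ^ (f.totalDegree - k) * homogeneousComponent k f

theorem isHomogeneous_homog (i : ι) (f : MvPolynomial ι ℂ) :
    (homog i f).IsHomogeneous f.totalDegree := by
  refine IsHomogeneous.sum _ _ _ fun k hk => ?_
  have h := ((isHomogeneous_X ℂ i).pow (f.totalDegree - k)).mul
    (homogeneousComponent_isHomogeneous k f)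
  have hk' : 1 * (f.totalDegree - k) + k = f.totalDegree := by
    have := Finset.mem_range.1 hk
    omega
  rwa [hk'] at h

theorem aeval_homog {B : Type} [CommRing B] [Algebra ℂ B] (i : ι) (f : MvPolynomial ι ℂ)
    (y : ι → B) (hy : y i = 1) : aeval y (homog i f) = aeval y f := by
  conv_rhs => rw [← sum_homogeneousComponent f]
  simp [homog, hy]

theorem evalAt_homog (i : ι) (f : MvPolynomial ι ℂ) (x : AffSpace ι) (hx : x i = (1 : ℂ)) :
    evalAt x (homog i f) = evalAt x f :=
  aeval_homog i f (fun j => (x j : ℂ)) hx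

/-- The points of affine space with `i`-th coordinate `1`. -/
abbrev Slice (i : ι) : Type := {x : AffSpace ι // x i = (1 : ℂ)}

theorem Slice.ne_zero {i : ι} (x : Slice i) : x.1 ≠ 0 := fun h =>
  one_ne_zero (x.2.symm.trans (congrFun h i))

/-- The standard affine chart of projective space where the `i`-th coordinate is nonzero. -/
def chart (i : ι) (x : Slice i) : ProjSpace ι := ofCoord x.1 x.ne_zero

theorem range_chart (i : ι) : Set.range (chart i) = {T | evalAt (hcoord T) (X i) ≠ 0} := by
  ext T
  constructor
  · rintro ⟨x, rfl⟩
    refine (evalAt_hcoord_ofCoord_ne_zero_iff (isHomogeneous_X ℂ i) _ _).2 ?_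
    rw [evalAt_X, x.2]
    exact one_ne_zero
  · intro hT
    rw [Set.mem_ofPred_eq, evalAt_X] at hT
    refine ⟨⟨fun j => (hcoord T i)⁻¹ * hcoord T j, inv_mul_cancel₀ hT⟩, ?_⟩
    conv_rhs => rw [← ofCoord_hcoord T]
    exact (ofCoord_eq_iff _ _ _ _).2 ⟨_, rfl⟩

theorem isOpenEmbedding_chart (i : ι) : IsOpenEmbedding (chart i) := by
  refine ⟨⟨⟨le_antisymm ?_ ?_⟩, ?_⟩, ?_⟩
  · rw [← continuous_iff_le_induced]
    refine (isTopologicalBasis_projSpace ι).continuous_iff.2 ?_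
    rintro _ ⟨f, k, hf, rfl⟩
    simp only [Set.preimage_ofPred_eq, chart, evalAt_hcoord_ofCoord_ne_zero_iff hf]
    exact (isOpen_evalAt_ne_zero f).preimage continuous_subtype_val
  -- An open set `{f ≠ 0}` of the slice is cut out by the homogenization of `f`.
  · rw [instTopologicalSpaceSubtype, ← continuous_iff_le_induced]
    refine continuous_generateFrom_iff.2 ?_
    rintro _ ⟨f, rfl⟩
    refine ⟨_, isOpen_evalAt_hcoord_ne_zero (isHomogeneous_homog i f), ?_⟩
    ext x
    simp only [Set.preimage_ofPred_eq, Set.mem_ofPred_eq, chart,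
      evalAt_hcoord_ofCoord_ne_zero_iff (isHomogeneous_homog i f), evalAt_homog i f x.1 x.2]
    rfl
  · rintro x y hxy
    obtain ⟨a, ha⟩ := (ofCoord_eq_iff _ _ _ _).1 hxy
    have h1 : (1 : ℂ) = a * 1 := by
      have := congrFun ha i
      rwa [x.2, y.2] at this
    rw [mul_one] at h1
    subst h1
    exact Subtype.ext (ha.trans (funext fun i => one_mul _))
  · rw [range_chart]
    exact isOpen_evalAt_hcoord_ne_zero (isHomogeneous_X ℂ i)

theorem mem_closure_iff_evalAt_hcoord (s : Set (ProjSpace ι)) (T : ProjSpace ι) :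
    T ∈ closure s ↔ ∀ (f : MvPolynomial ι ℂ) (k : ℕ), f.IsHomogeneous k →
      (∀ y ∈ s, evalAt (hcoord y) f = 0) → evalAt (hcoord T) f = 0 := by
  rw [(isTopologicalBasis_projSpace ι).mem_closure_iff]
  constructor
  · intro h f k hfk hf
    by_contra hx
    obtain ⟨y, hy, hys⟩ := h _ ⟨f, k, hfk, rfl⟩ hx
    exact hy (hf y hys)
  · rintro h _ ⟨f, k, hfk, rfl⟩ hx
    by_contra hne
    refine hx (h f k hfk fun y hy => ?_)
    by_contra hy0
    exact hne ⟨y, hy0, hy⟩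

/-- The Zariski closure of the image of a polynomial map is cut out by the homogeneous polynomials
that vanish identically on substituting the polynomials `t`. -/
theorem ofCoord_mem_closure_range_projMap_iff {t : ι → MvPolynomial κ ℂ}
    {ht : ∀ z, polyMap t z ≠ 0} (x : AffSpace ι) (hx : x ≠ 0) :
    ofCoord x hx ∈ closure (Set.range (projMap t ht)) ↔
      ∀ (f : MvPolynomial ι ℂ) (k : ℕ), f.IsHomogeneous k → aeval t f = 0 → evalAt x f = 0 := by
  rw [mem_closure_iff_evalAt_hcoord]
  refine forall_congr' fun f => forall_congr' fun k => forall_congr' fun hf => ?_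
  refine imp_congr ?_ (not_iff_not.1 (evalAt_hcoord_ofCoord_ne_zero_iff hf x hx))
  rw [Set.forall_mem_range]
  have : ∀ z, evalAt (hcoord (projMap t ht z)) f = 0 ↔ evalAt z (aeval t f) = 0 := fun z => by
    rw [← evalAt_polyMap]
    exact not_iff_not.1 (evalAt_hcoord_ofCoord_ne_zero_iff hf _ (ht z))
  simp only [this]
  constructor
  · intro h
    by_contra hne
    obtain ⟨z, hz⟩ := exists_evalAt_ne_zero hne
    exact hz (h z)
  · intro h z
    rw [h, map_zero]

end Projective

/-! ### The dimension of the closure of the image of a polynomial map -/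

noncomputable section ProjectiveDim

open MvPolynomial TopologicalSpace Topology
open scoped IntermediateField.algebraAdjoinAdjoin

variable {ι κ : Type}

/-- The substitution `X j ↦ t j / t i`, with values in the field of rational functions. -/
def chartHom (t : ι → MvPolynomial κ ℂ) (i : ι) :
    MvPolynomial ι ℂ →ₐ[ℂ] FractionRing (MvPolynomial κ ℂ) :=
  aeval fun j => algebraMap _ (FractionRing (MvPolynomial κ ℂ)) (t j) / algebraMap _ _ (t i)

theorem aeval_eq_zero_iff_chartHom {t : ι → MvPolynomial κ ℂ} {i : ι} (hi : t i ≠ 0)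
    {f : MvPolynomial ι ℂ} {k : ℕ} (hf : f.IsHomogeneous k) :
    aeval t f = 0 ↔ chartHom t i f = 0 := by
  have hinj := IsFractionRing.injective (MvPolynomial κ ℂ) (FractionRing (MvPolynomial κ ℂ))
  have hi' : algebraMap _ (FractionRing (MvPolynomial κ ℂ)) (t i) ≠ 0 := by
    rwa [Ne, map_eq_zero_iff _ hinj]
  have h1 : chartHom t i f = (algebraMap _ _ (t i))⁻¹ ^ k *
      algebraMap (MvPolynomial κ ℂ) (FractionRing (MvPolynomial κ ℂ)) (aeval t f) := by
    rw [chartHom, ← aeval_algebraMap_apply, ← aeval_mul_of_isHomogeneous hf]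
    simp only [div_eq_inv_mul, Function.comp_def]
  rw [h1, mul_eq_zero, map_eq_zero_iff _ hinj]
  simp [hi']

variable {t : ι → MvPolynomial κ ℂ} {ht : ∀ z, polyMap t z ≠ 0}

/-- In the `i`-th standard chart, the closure of the image of `projMap t ht` is the affine variety
of the kernel of the substitution `X j ↦ t j / t i`. -/
theorem mem_zeros_ker_chartHom_iff {i : ι} (hi : t i ≠ 0) (x : AffSpace ι) :
    x ∈ zeros (RingHom.ker (chartHom t i)) ↔
      ∃ h : x i = (1 : ℂ), chart i ⟨x, h⟩ ∈ closure (Set.range (projMap t ht)) := by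
  have hinj := IsFractionRing.injective (MvPolynomial κ ℂ) (FractionRing (MvPolynomial κ ℂ))
  have hi' : algebraMap _ (FractionRing (MvPolynomial κ ℂ)) (t i) ≠ 0 := by
    rwa [Ne, map_eq_zero_iff _ hinj]
  have hone : algebraMap _ (FractionRing (MvPolynomial κ ℂ)) (t i) / algebraMap _ _ (t i) = 1 :=
    div_self hi'
  simp only [chart, ofCoord_mem_closure_range_projMap_iff]
  constructor
  · intro hx
    have h1 : x i = (1 : ℂ) := by
      have h := hx (X i - 1) (by simp [RingHom.mem_ker, chartHom, hone])
      rw [map_sub, map_one, evalAt_X, sub_eq_zero] at h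
      exact h
    exact ⟨h1, fun f k hf h0 => hx f ((aeval_eq_zero_iff_chartHom hi hf).1 h0)⟩
  · rintro ⟨h1, hx⟩ f hf
    rw [← evalAt_homog i f x h1]
    refine hx _ _ (isHomogeneous_homog i f) ?_
    rw [aeval_eq_zero_iff_chartHom hi (isHomogeneous_homog i f)]
    exact (aeval_homog i f _ hone).trans hf

/-- The part of the closure of the image of `projMap t ht` in the `i`-th standard chart. -/
def chartPart (ht : ∀ z, polyMap t z ≠ 0) {i : ι} (hi : t i ≠ 0)
    (x : zeros (RingHom.ker (chartHom t i))) : closure (Set.range (projMap t ht)) :=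
  ⟨chart i ⟨x.1, ((mem_zeros_ker_chartHom_iff (ht := ht) hi x.1).1 x.2).1⟩,
    ((mem_zeros_ker_chartHom_iff hi x.1).1 x.2).2⟩

theorem range_chartPart {i : ι} (hi : t i ≠ 0) :
    Set.range (chartPart ht hi) = Subtype.val ⁻¹' {T | evalAt (hcoord T) (X i) ≠ 0} := by
  rw [← range_chart]
  ext T
  constructor
  · rintro ⟨x, rfl⟩
    exact ⟨_, rfl⟩
  · rintro ⟨x, hx⟩
    have hxT : chart i x ∈ closure (Set.range (projMap t ht)) := hx ▸ T.2
    exact ⟨⟨x.1, (mem_zeros_ker_chartHom_iff hi x.1).2 ⟨x.2, hxT⟩⟩, Subtype.ext hx⟩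

theorem isOpenEmbedding_chartPart {i : ι} (hi : t i ≠ 0) : IsOpenEmbedding (chartPart ht hi) := by
  refine ⟨?_, ?_⟩
  · have h1 : IsEmbedding fun x : zeros (RingHom.ker (chartHom t i)) =>
        (⟨x.1, ((mem_zeros_ker_chartHom_iff (ht := ht) hi x.1).1 x.2).1⟩ : Slice i) :=
      IsEmbedding.of_comp (by fun_prop) continuous_subtype_val IsEmbedding.subtypeVal
    have h2 : IsEmbedding (Subtype.val ∘ chartPart ht hi) :=
      (isOpenEmbedding_chart i).isEmbedding.comp h1
    exact IsEmbedding.of_comp (continuous_induced_rng.2 h2.continuous) continuous_subtype_val h2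
  · rw [range_chartPart hi]
    exact (isOpen_evalAt_hcoord_ne_zero (isHomogeneous_X ℂ i)).preimage continuous_subtype_val

/-- The field generated by the rational functions `t j`. -/
abbrev genField (t : ι → MvPolynomial κ ℂ) :
    IntermediateField ℂ (FractionRing (MvPolynomial κ ℂ)) :=
  IntermediateField.adjoin ℂ (Set.range fun j => algebraMap _ _ (t j))

theorem chartHom_mem_genField (i : ι) (f : MvPolynomial ι ℂ) : chartHom t i f ∈ genField t := by
  have hle : (chartHom t i).range ≤ (genField t).toSubalgebra := by
    rw [chartHom, ← Algebra.adjoin_range_eq_range_aeval, Algebra.adjoin_le_iff]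
    rintro _ ⟨j, rfl⟩
    exact (genField t).div_mem (IntermediateField.subset_adjoin _ _ ⟨j, rfl⟩)
      (IntermediateField.subset_adjoin _ _ ⟨i, rfl⟩)
  exact hle ⟨f, rfl⟩

theorem topologicalKrullDim_zeros_ker_chartHom [Finite ι] (i : ι) :
    topologicalKrullDim (zeros (RingHom.ker (chartHom t i))) =
      ((Algebra.trdeg ℂ (chartHom t i).range).toNat : WithBot ℕ∞) := by
  rw [topologicalKrullDim_zeros]
  have e := Ideal.quotientKerEquivRange (chartHom t i)
  rw [ringKrullDim_eq_of_ringEquiv e.toRingEquiv]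
  have : Algebra.FiniteType ℂ (chartHom t i).range :=
    Algebra.FiniteType.of_surjective (chartHom t i).rangeRestrict
      (chartHom t i).rangeRestrict_surjective
  exact ringKrullDim_eq_trdeg ℂ _

theorem trdeg_range_chartHom_le (i : ι) :
    Algebra.trdeg ℂ (chartHom t i).range ≤ Algebra.trdeg ℂ (genField t) := by
  have hle : (chartHom t i).range ≤ (genField t).toSubalgebra := by
    rintro _ ⟨f, rfl⟩
    exact chartHom_mem_genField i f
  exact trdeg_le_of_injective (A' := genField t) (Subalgebra.inclusion hle)
    (Subalgebra.inclusion_injective hle)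

theorem trdeg_algebraAdjoin (F : Type) {E : Type} [Field F] [Field E] [Algebra F E] (s : Set E) :
    Algebra.trdeg F (Algebra.adjoin F s) = Algebra.trdeg F (IntermediateField.adjoin F s) := by
  have h0 : Algebra.trdeg (Algebra.adjoin F s) (IntermediateField.adjoin F s) = 0 := trdeg_eq_zero
  rw [← trdeg_add_eq F (Algebra.adjoin F s) (A := IntermediateField.adjoin F s), h0, add_zero]

theorem trdeg_range_chartHom_eq {i : ι} (hi : t i = 1) :
    Algebra.trdeg ℂ (chartHom t i).range = Algebra.trdeg ℂ (genField t) := by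
  have hr : (chartHom t i).range = Algebra.adjoin ℂ (Set.range fun j =>
      algebraMap _ (FractionRing (MvPolynomial κ ℂ)) (t j)) := by
    rw [chartHom, ← Algebra.adjoin_range_eq_range_aeval]
    simp [hi]
  rw [hr, trdeg_algebraAdjoin]

theorem trdeg_fractionRing_mvPolynomial (κ : Type) :
    Algebra.trdeg ℂ (FractionRing (MvPolynomial κ ℂ)) = Cardinal.mk κ := by
  have h0 : Algebra.trdeg (MvPolynomial κ ℂ) (FractionRing (MvPolynomial κ ℂ)) = 0 :=
    have : Algebra.IsAlgebraic (MvPolynomial κ ℂ) (FractionRing (MvPolynomial κ ℂ)) :=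
      IsLocalization.isAlgebraic _ (nonZeroDivisors (MvPolynomial κ ℂ))
    trdeg_eq_zero
  rw [← trdeg_add_eq ℂ (MvPolynomial κ ℂ) (A := FractionRing (MvPolynomial κ ℂ)), h0, add_zero]
  simp

theorem trdeg_genField_lt_aleph0 [Finite κ] :
    Algebra.trdeg ℂ (genField t) < Cardinal.aleph0 := by
  refine (trdeg_le_of_injective (genField t).val (genField t).val.injective).trans_lt ?_
  rw [trdeg_fractionRing_mvPolynomial]
  exact Cardinal.mk_lt_aleph0

/-- The closure of the image of a map to projective space given by polynomials `t j`, one of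
which is `1`, has dimension the transcendence degree of `ℂ(t)`. -/
theorem topologicalKrullDim_closure_range_projMap [Finite ι] [Finite κ] {i₀ : ι}
    (h₀ : t i₀ = 1) :
    topologicalKrullDim (closure (Set.range (projMap t ht))) =
      ((Algebra.trdeg ℂ (genField t)).toNat : WithBot ℕ∞) := by
  apply le_antisymm
  -- A chain of irreducible closed sets can be followed in a chart that meets its smallest member,
  -- and the coordinate ring of that chart embeds into the field generated by all `t j`.
  · refine iSup_le fun l => ?_
    obtain ⟨T, hT⟩ := l.head.isIrreducible.nonempty
    obtain ⟨i, hi⟩ : ∃ i, hcoord T.1 i ≠ (0 : ℂ) := by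
      by_contra! h
      exact hcoord_ne_zero T.1 (funext h)
    have hti : t i ≠ 0 := by
      intro hti
      refine hi ?_
      have := (mem_closure_iff_evalAt_hcoord _ _).1 T.2 (X i) 1 (isHomogeneous_X ℂ i) ?_
      · simpa using this
      · rintro _ ⟨z, rfl⟩
        refine (not_iff_not.1 (evalAt_hcoord_ofCoord_ne_zero_iff (isHomogeneous_X ℂ i) _ _)).2 ?_
        simp [polyMap, hti]
    have hmeet : ∀ C : IrreducibleCloseds (closure (Set.range (projMap t ht))), l.head ≤ C →
        (chartPart ht hti ⁻¹' (C : Set _)).Nonempty := by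
      intro C hC
      have : T ∈ Set.range (chartPart ht hti) := by
        rw [range_chartPart]
        simpa using hi
      obtain ⟨x, hx⟩ := this
      exact ⟨x, hC (hx ▸ hT)⟩
    let l' : LTSeries {C : IrreducibleCloseds (closure (Set.range (projMap t ht))) //
        (chartPart ht hti ⁻¹' (C : Set _)).Nonempty} :=
      { length := l.length
        toFun := fun j => ⟨l j, hmeet _ (l.head_le j)⟩
        step := fun j => l.step j }
    have h1 : (l.length : WithBot ℕ∞) ≤ _ := Order.LTSeries.length_le_krullDim l'
    refine h1.trans ?_
    have e := IrreducibleCloseds.orderIsoOfIsOpenEmbedding (chartPart ht hti)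
      (isOpenEmbedding_chartPart hti)
    refine (Order.krullDim_eq_of_orderIso e).ge.trans ?_
    refine (topologicalKrullDim_zeros_ker_chartHom i).le.trans ?_
    have := Cardinal.toNat_le_toNat (trdeg_range_chartHom_le (t := t) i) trdeg_genField_lt_aleph0
    exact_mod_cast this
  -- In the chart of the coordinate `1`, the coordinate ring generates this field.
  · have hi : t i₀ ≠ 0 := by rw [h₀]; exact one_ne_zero
    rw [← trdeg_range_chartHom_eq h₀, ← topologicalKrullDim_zeros_ker_chartHom]
    exact (isOpenEmbedding_chartPart (ht := ht) hi).isInducing.topologicalKrullDim_le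

end ProjectiveDim

/-! ### Minors and the rank of a matrix -/

section LinearAlgebra

variable {K : Type*} [Field K] {m n : Type*} [Fintype n]

theorem exists_linearIndependent_cols [Finite m] (A : Matrix m n K) {r : ℕ} (h : A.rank = r) :
    ∃ g : Fin r → n, LinearIndependent K fun i => A.col (g i) := by
  subst h
  obtain ⟨f, hf, -, hli⟩ := Submodule.exists_fun_fin_finrank_span_eq K (Set.range A.col)
  choose g hg using hf
  rw [Matrix.rank_eq_finrank_span_cols]
  exact ⟨g, by simpa only [hg] using hli⟩

theorem exists_submatrix_det_ne_zero [Fintype m] (A : Matrix m n K) :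
    ∃ (f : Fin A.rank → m) (g : Fin A.rank → n), (A.submatrix f g).det ≠ 0 := by
  obtain ⟨g, hg⟩ := exists_linearIndependent_cols A rfl
  have hr : (A.submatrix id g).transpose.rank = A.rank := by
    have := LinearIndependent.rank_matrix (M := (A.submatrix id g).transpose) hg
    simpa using this
  rw [Matrix.rank_transpose] at hr
  obtain ⟨f, hf⟩ := exists_linearIndependent_cols (A.submatrix id g).transpose
    ((Matrix.rank_transpose _).trans hr)
  refine ⟨f, g, ?_⟩
  have : IsUnit (A.submatrix f g) := Matrix.linearIndependent_rows_iff_isUnit.1 hf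
  exact ((Matrix.isUnit_iff_isUnit_det _).1 this).ne_zero

theorem le_rank_of_submatrix_det_ne_zero (A : Matrix m n K) {k : ℕ} (f : Fin k → m)
    (g : Fin k → n) (h : (A.submatrix f g).det ≠ 0) : k ≤ A.rank := by
  have h1 := Matrix.rank_of_det_ne_zero h
  rw [Fintype.card_fin] at h1
  rw [← h1]
  exact Matrix.rank_submatrix_le A f g

end LinearAlgebra

/-! ### Fields generated by the solution of a linear system -/

section LinearSystem

open MvPolynomial

variable {K L : Type} [Field K] [Field L] [Algebra K L] {ρ τ : Type} [Fintype ρ] [Fintype τ]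

/-- Elements `s i` of `L` are algebraically independent over `K` if some embedding over `K` of `L`
into the rational functions over `L` moves each `s i` to `s i + X i`. -/
theorem algebraicIndependent_of_shift {k : ℕ} (s : Fin k → L)
    (Θ : L →+* FractionRing (MvPolynomial (Fin k) L))
    (hΘ : ∀ a : K, Θ (algebraMap K L a) = algebraMap (MvPolynomial (Fin k) L) _
      (C (algebraMap K L a)))
    (hs : ∀ i, Θ (s i) = algebraMap (MvPolynomial (Fin k) L) _ (C (s i) + X i)) :
    AlgebraicIndependent K s := by
  rw [algebraicIndependent_iff]
  intro p hp
  have h1 : aeval (fun i => C (s i) + X i : Fin k → MvPolynomial (Fin k) L)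
      (map (algebraMap K L) p) = 0 := by
    apply IsFractionRing.injective (MvPolynomial (Fin k) L)
      (FractionRing (MvPolynomial (Fin k) L))
    rw [map_zero, ← map_zero Θ, ← hp]
    clear hp
    induction p using MvPolynomial.induction_on with
    | C a => simp [hΘ, algebraMap_eq]
    | add f g hf hg => simp only [map_add, hf, hg]
    | mul_X f i hf => simp only [map_mul, hf, map_X, aeval_X, hs]
  -- The translation `X i ↦ X i - C (s i)` recovers `p` from its value at `C (s i) + X i`.
  have h2 : aeval (fun i => X i - C (s i) : Fin k → MvPolynomial (Fin k) L)
      (aeval (fun i => C (s i) + X i : Fin k → MvPolynomial (Fin k) L)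
        (map (algebraMap K L) p)) = map (algebraMap K L) p := by
    generalize map (algebraMap K L) p = f
    rw [← AlgHom.comp_apply, comp_aeval]
    conv_rhs => rw [← aeval_X_left_apply f]
    congr 2
    ext i
    simp [algHom_C]
  rw [h1, map_zero] at h2
  exact map_injective _ (algebraMap K L).injective (h2.symm.trans (map_zero _).symm)

/-- If `L` is generated over `K` by a solution `q` of a linear system `A q = b` over `K`, and if
every tuple of kernel vectors `v i` of `A` gives an embedding of `L` over `K` that moves `q`
to `q + ∑ i, X i • v i` with independent variables `X i`, then the transcendence degree of `L`
over `K` is the dimension of the kernel of `A`. -/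
theorem trdeg_eq_card_sub_rank (A : Matrix ρ τ K) (b : ρ → K) (q : τ → L)
    (hq : ∀ a, ∑ j, algebraMap K L (A a j) * q j = algebraMap K L (b a))
    (hgen : IntermediateField.adjoin K (Set.range q) = ⊤)
    (hΘ : ∀ (k : ℕ) (v : Fin k → τ → K), (∀ i, A.mulVec (v i) = 0) →
      ∃ Θ : L →+* FractionRing (MvPolynomial (Fin k) L),
        (∀ a : K, Θ (algebraMap K L a) = algebraMap (MvPolynomial (Fin k) L) _
          (C (algebraMap K L a))) ∧
        ∀ j, Θ (q j) = algebraMap (MvPolynomial (Fin k) L) _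
          (C (q j) + ∑ i, C (algebraMap K L (v i j)) * X i)) :
    Algebra.trdeg K L = (Fintype.card τ - A.rank : ℕ) := by
  classical
  have hk : Module.finrank K (LinearMap.ker A.mulVecLin) = Fintype.card τ - A.rank := by
    have h := LinearMap.finrank_range_add_finrank_ker A.mulVecLin
    rw [Module.finrank_fintype_fun_eq_card] at h
    change A.rank + _ = _ at h
    omega
  set k := Fintype.card τ - A.rank
  let v := Module.finBasisOfFinrankEq K (LinearMap.ker A.mulVecLin) hk
  -- A linear left inverse of the inclusion of the kernel, in the coordinates of `v`.
  obtain ⟨G, hG⟩ := LinearMap.exists_leftInverse_of_injective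
    ((LinearMap.ker A.mulVecLin).subtype ∘ₗ v.equivFun.symm.toLinearMap)
    (LinearMap.ker_eq_bot.2 (Subtype.val_injective.comp v.equivFun.symm.injective))
  have hGv : ∀ i, G (v i).1 = Pi.single i 1 := fun i => by
    have := LinearMap.congr_fun hG (Pi.single i 1)
    simpa [Module.Basis.equivFun_symm_apply] using this
  -- The equations `A x = b` and the coordinates `G x` together determine `x` linearly.
  obtain ⟨H, hH⟩ := LinearMap.exists_leftInverse_of_injective (A.mulVecLin.prod G) (by
    rw [LinearMap.ker_eq_bot']
    intro x hx
    obtain ⟨h1, h2⟩ := Prod.ext_iff.1 hx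
    have := LinearMap.congr_fun hG (v.equivFun ⟨x, h1⟩)
    have h3 : G x = v.equivFun ⟨x, h1⟩ := by simpa using this
    have h4 : v.equivFun ⟨x, h1⟩ = 0 := h3.symm.trans h2
    rw [LinearEquiv.map_eq_zero_iff] at h4
    exact congrArg Subtype.val h4)
  -- The coordinates `s` of the solution `q` along the kernel form a transcendence basis: they are
  -- independent by the shift, and they generate `L` because `q` is linear in `b` and `s`.
  let Gm : Matrix (Fin k) τ K := LinearMap.toMatrix' G
  let s : Fin k → L := fun i => ∑ j, algebraMap K L (Gm i j) * q j
  have hmv : ∀ i l, ∑ j, Gm i j * (v l).1 j = if l = i then 1 else 0 := by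
    intro i l
    have : Gm.mulVec (v l).1 i = (Pi.single l 1 : Fin k → K) i := by
      rw [← hGv l, ← Matrix.toLin'_apply, Matrix.toLin'_toMatrix']
    rw [Pi.single_apply] at this
    simpa [Matrix.mulVec, dotProduct, eq_comm] using this
  have hind : AlgebraicIndependent K s := by
    obtain ⟨Θ, hΘK, hΘq⟩ := hΘ k (fun i => (v i).1) fun i => (v i).2
    refine algebraicIndependent_of_shift s Θ hΘK fun i => ?_
    simp only [s, map_sum, map_mul, hΘK, hΘq]
    simp only [← map_mul, ← map_sum]
    congr 1
    simp only [mul_add, Finset.sum_add_distrib, map_sum, map_mul]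
    congr 1
    simp only [Finset.mul_sum]
    rw [Finset.sum_comm]
    have : ∀ l, ∑ j, C (algebraMap K L (Gm i j)) * (C (algebraMap K L ((v l).1 j)) * X l) =
        (C (algebraMap K L (if l = i then 1 else 0)) * X l : MvPolynomial (Fin k) L) := by
      intro l
      rw [← hmv i l]
      simp only [map_sum, map_mul, Finset.sum_mul, mul_assoc]
    simp only [this]
    simp
  have hmem : ∀ j, q j ∈ IntermediateField.adjoin K (Set.range s) := by
    let H₁ : Matrix τ ρ K := LinearMap.toMatrix' (H ∘ₗ LinearMap.inl K _ _)
    let H₂ : Matrix τ (Fin k) K := LinearMap.toMatrix' (H ∘ₗ LinearMap.inr K _ _)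
    have hone : H₁ * A + H₂ * Gm = 1 := by
      apply Matrix.toLin'.injective
      refine LinearMap.ext fun x => ?_
      have h1 := LinearMap.congr_fun hH x
      have h2 : ((A.mulVecLin.prod G) x) = (A.mulVec x, 0) + (0, G x) := by simp
      rw [LinearMap.comp_apply, h2, map_add] at h1
      simpa [H₁, H₂, Gm, Matrix.toLin'_mul] using h1
    let f := algebraMap K L
    have hA : (A.map f).mulVec q = f ∘ b := funext hq
    have hs : (Gm.map f).mulVec q = s := rfl
    have h1 : q = (H₁.map f).mulVec (f ∘ b) + (H₂.map f).mulVec s := by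
      rw [← hA, ← hs, Matrix.mulVec_mulVec, Matrix.mulVec_mulVec, ← Matrix.add_mulVec,
        ← Matrix.map_mul, ← Matrix.map_mul, ← Matrix.map_add _ (map_add f), hone,
        Matrix.map_one _ (map_zero f) (map_one f), Matrix.one_mulVec]
    intro j
    rw [h1]
    have h2 : ∑ a, f (H₁ j a) * f (b a) ∈ IntermediateField.adjoin K (Set.range s) :=
      sum_mem fun a _ =>
        mul_mem (IntermediateField.algebraMap_mem _ _) (IntermediateField.algebraMap_mem _ _)
    have h3 : ∑ i, f (H₂ j i) * s i ∈ IntermediateField.adjoin K (Set.range s) :=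
      sum_mem fun i _ => mul_mem (IntermediateField.algebraMap_mem _ _)
        (IntermediateField.subset_adjoin _ _ ⟨i, rfl⟩)
    exact add_mem h2 h3
  have htop : IntermediateField.adjoin K (Set.range s) = ⊤ := by
    rw [eq_top_iff, ← hgen, IntermediateField.adjoin_le_iff]
    rintro _ ⟨j, rfl⟩
    exact hmem j
  have halg : Algebra.IsAlgebraic (Algebra.adjoin K (Set.range s)) L := by
    rw [← IntermediateField.isAlgebraic_adjoin_iff_top, htop]
    infer_instance
  have hb := hind.isTranscendenceBasis_iff_isAlgebraic.2 halg
  have := hb.lift_cardinalMk_eq_trdeg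
  simpa using this.symm

end LinearSystem

/-! ### Quotients of polynomials and the Padé equations -/

noncomputable section PowerSeries

variable {B : Type} [CommRing B] {n d e m : ℕ}

theorem Mon.ne_zero {k : ℕ} (α : Mon n 1 k) : α.1 ≠ 0 := by
  intro h
  have := α.2.1
  rw [h] at this
  simp at this

/-- The power series `1 + ∑ p_α x^α`, the sum over all `α` with `1 ≤ |α| ≤ d`. -/
def normSeries (p : Mon n 1 d → B) : MvPowerSeries (Fin n) B :=
  1 + ∑ α : Mon n 1 d, MvPowerSeries.monomial α.1 (p α)

theorem constantCoeff_normSeries (p : Mon n 1 d → B) :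
    MvPowerSeries.constantCoeff (normSeries p) = 1 := by
  classical
  rw [← MvPowerSeries.coeff_zero_eq_constantCoeff_apply, normSeries, map_add, map_sum,
    MvPowerSeries.coeff_zero_one, Finset.sum_eq_zero, add_zero]
  intro α _
  rw [MvPowerSeries.coeff_monomial, if_neg α.ne_zero.symm]

theorem coeff_normSeries (p : Mon n 1 d → B) (α : Mon n 1 d) :
    MvPowerSeries.coeff α.1 (normSeries p) = p α := by
  classical
  rw [normSeries, map_add, map_sum, MvPowerSeries.coeff_one, if_neg α.ne_zero, zero_add,
    Finset.sum_eq_single α]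
  · rw [MvPowerSeries.coeff_monomial, if_pos rfl]
  · intro β _ hβ
    rw [MvPowerSeries.coeff_monomial, if_neg fun h => hβ (Subtype.ext h.symm)]
  · simp

theorem coeff_normSeries_of_lt (p : Mon n 1 d → B) (γ : Fin n →₀ ℕ) (hγ : d < γ.degree) :
    MvPowerSeries.coeff γ (normSeries p) = 0 := by
  classical
  have h0 : γ ≠ 0 := by
    rintro rfl
    simp at hγ
  rw [normSeries, map_add, map_sum, MvPowerSeries.coeff_one, if_neg h0, zero_add]
  refine Finset.sum_eq_zero fun α _ => ?_
  rw [MvPowerSeries.coeff_monomial, if_neg]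
  rintro rfl
  exact absurd α.2.2 (not_le.2 hγ)

/-- The power series of the quotient of two polynomials with constant coefficient `1`. The unit
`1` that `invOfUnit` takes is the constant coefficient of the denominator. -/
def quotSeries (p : Mon n 1 d → B) (q : Mon n 1 e → B) : MvPowerSeries (Fin n) B :=
  normSeries p * (normSeries q).invOfUnit 1

theorem normSeries_mul_quotSeries (p : Mon n 1 d → B) (q : Mon n 1 e → B) :
    normSeries q * quotSeries p q = normSeries p := by
  rw [quotSeries, mul_left_comm, MvPowerSeries.mul_invOfUnit _ _ (constantCoeff_normSeries q),
    mul_one]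

theorem map_normSeries {B' : Type} [CommRing B'] (f : B →+* B') (p : Mon n 1 d → B) :
    MvPowerSeries.map f (normSeries p) = normSeries fun α => f (p α) := by
  simp [normSeries]

theorem map_quotSeries {B' : Type} [CommRing B'] (f : B →+* B') (p : Mon n 1 d → B)
    (q : Mon n 1 e → B) :
    MvPowerSeries.map f (quotSeries p q) = quotSeries (fun α => f (p α)) fun β => f (q β) := by
  have h1 := congrArg (MvPowerSeries.map f) (normSeries_mul_quotSeries p q)
  rw [map_mul, map_normSeries, map_normSeries] at h1
  conv_rhs => rw [quotSeries]
  rw [← h1, mul_right_comm, MvPowerSeries.mul_invOfUnit _ _ (constantCoeff_normSeries _), one_mul]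

theorem taylorCoeff_normPoly (p : Mon n 1 d → ℂ) (q : Mon n 1 e → ℂ) (γ : Mon n 0 m) :
    taylorCoeff n m (normPoly n d p) (normPoly n e q) γ =
      MvPowerSeries.coeff γ.1 (quotSeries p q) := by
  have hcoe : ∀ {k : ℕ} (p : Mon n 1 k → ℂ),
      (normPoly n k p : MvPowerSeries (Fin n) ℂ) = normSeries p := by
    intro k p
    rw [normPoly, normSeries, MvPolynomial.coe_add, MvPolynomial.coe_one]
    congr 1
    rw [← MvPolynomial.coeToMvPowerSeries.ringHom_apply, map_sum]
    simp
  rw [taylorCoeff, hcoe, hcoe, quotSeries,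
    MvPowerSeries.invOfUnit_eq' _ 1 (constantCoeff_normSeries q)]

/-- The coefficients of degree at most `m` of `χ * φ` depend only on those of `φ`. -/
theorem coeff_mul_congr {φ ψ : MvPowerSeries (Fin n) B}
    (h : ∀ γ : Fin n →₀ ℕ, γ.degree ≤ m → MvPowerSeries.coeff γ φ = MvPowerSeries.coeff γ ψ)
    (χ : MvPowerSeries (Fin n) B) (γ : Fin n →₀ ℕ) (hγ : γ.degree ≤ m) :
    MvPowerSeries.coeff γ (χ * φ) = MvPowerSeries.coeff γ (χ * ψ) := by
  classical
  rw [MvPowerSeries.coeff_mul, MvPowerSeries.coeff_mul]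
  refine Finset.sum_congr rfl fun x hx => ?_
  rw [h]
  rw [Finset.HasAntidiagonal.mem_antidiagonal] at hx
  exact (Finsupp.degree_mono (hx ▸ le_add_self)).trans hγ

/-- The polynomial with coefficients `c`, as a power series. -/
def polySeries (c : Mon n 0 m → B) : MvPowerSeries (Fin n) B := fun γ =>
  if h : γ.degree ≤ m then c ⟨γ, Nat.zero_le _, h⟩ else 0

theorem coeff_polySeries (c : Mon n 0 m → B) (γ : Fin n →₀ ℕ) (h : γ.degree ≤ m) :
    MvPowerSeries.coeff γ (polySeries c) = c ⟨γ, Nat.zero_le _, h⟩ := by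
  rw [MvPowerSeries.coeff_apply, polySeries, dif_pos h]

theorem map_polySeries {B' : Type} [CommRing B'] (f : B →+* B') (c : Mon n 0 m → B) :
    MvPowerSeries.map f (polySeries c) = polySeries fun γ => f (c γ) := by
  ext γ
  rw [MvPowerSeries.coeff_map, MvPowerSeries.coeff_apply, MvPowerSeries.coeff_apply,
    polySeries, polySeries, apply_dite f, map_zero]

open Classical in
/-- The coefficient of `x^α` in the product of `x^β` with the polynomial with coefficients `c`.
These are the entries of the Padé matrix, over an arbitrary ring. -/
def shiftCoeff (c : Mon n 0 m → B) (α β : Fin n →₀ ℕ) : B :=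
  if β ≤ α then MvPowerSeries.coeff (α - β) (polySeries c) else 0

theorem map_shiftCoeff {B' : Type} [CommRing B'] (f : B →+* B') (c : Mon n 0 m → B)
    (α β : Fin n →₀ ℕ) : f (shiftCoeff c α β) = shiftCoeff (fun γ => f (c γ)) α β := by
  rw [shiftCoeff, shiftCoeff, apply_ite f, map_zero, ← map_polySeries, MvPowerSeries.coeff_map]

theorem coeff_normSeries_mul_polySeries (q : Mon n 1 e → B) (c : Mon n 0 m → B)
    (α : Fin n →₀ ℕ) :
    MvPowerSeries.coeff α (normSeries q * polySeries c) =
      MvPowerSeries.coeff α (polySeries c) + ∑ β : Mon n 1 e, shiftCoeff c α β.1 * q β := by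
  classical
  rw [normSeries, add_mul, one_mul, Finset.sum_mul, map_add, map_sum]
  congr 1
  refine Finset.sum_congr rfl fun β _ => ?_
  rw [MvPowerSeries.coeff_monomial_mul, shiftCoeff, ite_mul, zero_mul, mul_comm]

/-- The polynomial of degree at most `m` with coefficients `c` is the Taylor polynomial of the
quotient given by `p` and `q` if and only if `q` solves the linear system of the reduced Padé
matrix of `c`, and `p` is the low degree part of the product of the denominator with the
polynomial. -/
theorem coeff_quotSeries_eq_iff (hdm : ∀ α : Mon n 1 d, α.1.degree ≤ m)
    (p : Mon n 1 d → B) (q : Mon n 1 e → B) (c : Mon n 0 m → B)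
    (h0 : c ⟨0, by simp⟩ = 1) :
    (∀ γ : Mon n 0 m, MvPowerSeries.coeff γ.1 (quotSeries p q) = c γ) ↔
      (∀ α : Mon n (d + 1) m, ∑ β : Mon n 1 e, shiftCoeff c α.1 β.1 * q β =
        - c ⟨α.1, Nat.zero_le _, α.2.2⟩) ∧
      ∀ α : Mon n 1 d, p α = c ⟨α.1, Nat.zero_le _, hdm α⟩ +
        ∑ β : Mon n 1 e, shiftCoeff c α.1 β.1 * q β := by
  have h1 : (∀ γ : Mon n 0 m, MvPowerSeries.coeff γ.1 (quotSeries p q) = c γ) ↔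
      ∀ γ : Fin n →₀ ℕ, γ.degree ≤ m →
        MvPowerSeries.coeff γ (normSeries p) =
          MvPowerSeries.coeff γ (normSeries q * polySeries c) := by
    have hsplit : (∀ γ : Mon n 0 m, MvPowerSeries.coeff γ.1 (quotSeries p q) = c γ) ↔
      ∀ γ : Fin n →₀ ℕ, γ.degree ≤ m →
        MvPowerSeries.coeff γ (quotSeries p q) = MvPowerSeries.coeff γ (polySeries c) := by
      constructor
      · intro h γ hγ
        rw [coeff_polySeries c γ hγ]
        exact h ⟨γ, Nat.zero_le _, hγ⟩
      · intro h γ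
        rw [h γ.1 γ.2.2, coeff_polySeries c γ.1 γ.2.2]
    rw [hsplit]
    -- Multiplication by the denominator, or by its inverse, preserves equality up to degree `m`.
    constructor
    · intro h
      have := coeff_mul_congr h (normSeries q)
      rwa [normSeries_mul_quotSeries] at this
    · intro h γ hγ
      have := coeff_mul_congr h ((normSeries q).invOfUnit 1) γ hγ
      rwa [← mul_assoc, MvPowerSeries.invOfUnit_mul _ _ (constantCoeff_normSeries q), one_mul,
        mul_comm] at this
  rw [h1]
  simp only [coeff_normSeries_mul_polySeries]
  constructor
  · intro h
    constructor
    · intro α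
      have := h α.1 α.2.2
      rw [coeff_normSeries_of_lt p _ α.2.1, coeff_polySeries c _ α.2.2] at this
      rw [eq_neg_iff_add_eq_zero, add_comm]
      exact this.symm
    · intro α
      have := h α.1 (hdm α)
      rwa [coeff_normSeries, coeff_polySeries c _ (hdm α)] at this
  -- Degrees above `d` give the linear system, degrees from `1` to `d` give the numerator, and
  -- degree `0` is the normalization.
  · rintro ⟨hA, hp⟩ γ hγ
    rcases Nat.lt_or_ge d γ.degree with hd | hd
    · rw [coeff_normSeries_of_lt p _ hd, coeff_polySeries c _ hγ, hA ⟨γ, hd, hγ⟩,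
        add_neg_cancel]
    rcases Nat.eq_zero_or_pos γ.degree with h | h
    · obtain rfl : γ = 0 := (Finsupp.degree_eq_zero_iff γ).1 h
      rw [MvPowerSeries.coeff_zero_eq_constantCoeff_apply, constantCoeff_normSeries,
        coeff_polySeries c _ hγ, h0, Finset.sum_eq_zero, add_zero]
      intro β _
      rw [shiftCoeff, if_neg, zero_mul]
      exact fun hle => β.ne_zero (le_antisymm hle zero_le)
    · have := hp ⟨γ, h, hd⟩
      rw [coeff_polySeries c _ hγ, ← this]
      exact coeff_normSeries p ⟨γ, h, hd⟩

end PowerSeries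

/-! ### The field generated by the Taylor coefficients -/

noncomputable section GenericRank

open MvPolynomial

theorem trdeg_intermediateField_add_eq {F E : Type} [Field F] [Field E] [Algebra F E]
    (K : IntermediateField F E) :
    Algebra.trdeg F K + Algebra.trdeg K E = Algebra.trdeg F E :=
  trdeg_add_eq F K

variable (n d e m : ℕ)

/-- The Taylor coefficients of the quotient, as polynomials in the coefficients of the numerator
and of the denominator. -/
def taylorPoly (γ : Mon n 0 m) : MvPolynomial (Mon n 1 d ⊕ Mon n 1 e) ℂ :=
  MvPowerSeries.coeff γ.1 (quotSeries (fun α => X (Sum.inl α)) fun β => X (Sum.inr β))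

variable {n d e m}

theorem map_taylorPoly {B : Type} [CommRing B]
    (f : MvPolynomial (Mon n 1 d ⊕ Mon n 1 e) ℂ →+* B) (γ : Mon n 0 m) :
    f (taylorPoly n d e m γ) = MvPowerSeries.coeff γ.1
      (quotSeries (fun α => f (X (Sum.inl α))) fun β => f (X (Sum.inr β))) := by
  rw [← map_quotSeries, MvPowerSeries.coeff_map, taylorPoly]

theorem taylorPoly_zero : taylorPoly n d e m ⟨0, by simp⟩ = 1 := by
  have h := congrArg MvPowerSeries.constantCoeff (normSeries_mul_quotSeries
    (fun α : Mon n 1 d => (X (Sum.inl α) : MvPolynomial (Mon n 1 d ⊕ Mon n 1 e) ℂ))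
    fun β => X (Sum.inr β))
  rwa [map_mul, constantCoeff_normSeries, constantCoeff_normSeries, one_mul] at h

variable (n d e m)

/-- The ring of polynomials in the coefficients of numerator and denominator. -/
abbrev CoeffRing : Type := MvPolynomial (Mon n 1 d ⊕ Mon n 1 e) ℂ

/-- The field of rational functions in the coefficients of numerator and denominator. -/
abbrev CoeffField : Type := FractionRing (CoeffRing n d e)

/-- The generic coefficient of the numerator. -/
def numCoeff (α : Mon n 1 d) : CoeffField n d e :=
  algebraMap (CoeffRing n d e) (CoeffField n d e) (X (Sum.inl α))

/-- The generic coefficient of the denominator. -/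
def denCoeff (β : Mon n 1 e) : CoeffField n d e :=
  algebraMap (CoeffRing n d e) (CoeffField n d e) (X (Sum.inr β))

/-- The generic Taylor coefficient. -/
def ratCoeff (γ : Mon n 0 m) : CoeffField n d e :=
  algebraMap (CoeffRing n d e) (CoeffField n d e) (taylorPoly n d e m γ)

/-- The Taylor coefficients as elements of the field they generate. -/
def genCoeff (γ : Mon n 0 m) : genField (taylorPoly n d e m) :=
  ⟨ratCoeff n d e m γ,
    IntermediateField.subset_adjoin _ _ ⟨γ, rfl⟩⟩

/-- The reduced Padé matrix of the generic Taylor polynomial. -/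
def genPadeMatrix : Matrix (Mon n (d + 1) m) (Mon n 1 e) (genField (taylorPoly n d e m)) :=
  Matrix.of fun α β => shiftCoeff (genCoeff n d e m) α.1 β.1

variable {n d e m}

theorem algebraMap_genPadeMatrix (α : Mon n (d + 1) m) (β : Mon n 1 e) :
    algebraMap _ (CoeffField n d e) (genPadeMatrix n d e m α β) =
      shiftCoeff (ratCoeff n d e m) α.1 β.1 :=
  map_shiftCoeff (algebraMap (genField (taylorPoly n d e m)) (CoeffField n d e)) _ _ _

/-- The equations that the generic numerator and denominator satisfy over the field generated by
the Taylor coefficients. -/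
theorem generic_equations (hdm : ∀ α : Mon n 1 d, α.1.degree ≤ m) :
    (∀ α : Mon n (d + 1) m, ∑ β : Mon n 1 e,
      shiftCoeff (ratCoeff n d e m) α.1 β.1 *
        denCoeff n d e β =
        - ratCoeff n d e m ⟨α.1, Nat.zero_le _, α.2.2⟩) ∧
      ∀ α : Mon n 1 d, numCoeff n d e α =
        ratCoeff n d e m ⟨α.1, Nat.zero_le _, hdm α⟩ +
        ∑ β : Mon n 1 e,
          shiftCoeff (ratCoeff n d e m) α.1 β.1 *
            denCoeff n d e β := by
  refine (coeff_quotSeries_eq_iff hdm (fun α => numCoeff n d e α)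
    (fun β => denCoeff n d e β)
    (ratCoeff n d e m) ?_).1 fun γ => ?_
  · rw [ratCoeff, taylorPoly_zero, map_one]
  · exact (map_taylorPoly (algebraMap _ (CoeffField n d e)) γ).symm

/-- The numerator is determined by the Taylor coefficients and the denominator. -/
theorem adjoin_denominator_eq_top (hdm : ∀ α : Mon n 1 d, α.1.degree ≤ m) :
    IntermediateField.adjoin (genField (taylorPoly n d e m))
      (Set.range fun β : Mon n 1 e => denCoeff n d e β) = ⊤ := by
  set E := IntermediateField.adjoin (genField (taylorPoly n d e m))
      (Set.range fun β : Mon n 1 e => denCoeff n d e β)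
  have hc : ∀ γ, ratCoeff n d e m γ ∈ E := fun γ =>
    E.algebraMap_mem (genCoeff n d e m γ)
  have hr : ∀ β, denCoeff n d e β ∈ E := fun β =>
    IntermediateField.subset_adjoin _ _ ⟨β, rfl⟩
  have hs : ∀ α β, shiftCoeff (ratCoeff n d e m) α β ∈ E := fun α β => by
    have := E.algebraMap_mem (shiftCoeff (genCoeff n d e m) α β)
    rwa [map_shiftCoeff] at this
  have hl : ∀ α, numCoeff n d e α ∈ E := fun α => by
    rw [(generic_equations hdm).2 α]
    exact add_mem (hc _) (sum_mem fun β _ => mul_mem (hs _ _) (hr β))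
  have hS : ∀ f : CoeffRing n d e, algebraMap _ (CoeffField n d e) f ∈ E := fun f => by
    induction f using MvPolynomial.induction_on with
    | C a => exact E.algebraMap_mem (algebraMap ℂ (genField (taylorPoly n d e m)) a)
    | add f g hf hg => rw [map_add]; exact add_mem hf hg
    | mul_X f i hf =>
      rw [map_mul]
      rcases i with α | β
      · exact mul_mem hf (hl α)
      · exact mul_mem hf (hr β)
  rw [eq_top_iff]
  intro x _
  obtain ⟨a, b, -, rfl⟩ := IsFractionRing.div_surjective
    (A := MvPolynomial (Mon n 1 d ⊕ Mon n 1 e) ℂ) x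
  exact div_mem (hS a) (hS b)

/-- The polynomial ring over the field of rational functions that carries the coordinates of a
displacement of the denominator. -/
abbrev ShiftRing (n d e k : ℕ) : Type := MvPolynomial (Fin k) (CoeffField n d e)

/-- Moving the denominator along the kernel of the generic reduced Padé matrix does not change
the Taylor polynomial. -/
theorem exists_shift (hdm : ∀ α : Mon n 1 d, α.1.degree ≤ m) (k : ℕ)
    (v : Fin k → Mon n 1 e → genField (taylorPoly n d e m))
    (hv : ∀ i, (genPadeMatrix n d e m).mulVec (v i) = 0) :
    ∃ Θ : CoeffField n d e →+* FractionRing (ShiftRing n d e k),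
      (∀ a : genField (taylorPoly n d e m), Θ (algebraMap _ (CoeffField n d e) a) =
        algebraMap (ShiftRing n d e k) _
          (C (algebraMap _ (CoeffField n d e) a))) ∧
      ∀ β, Θ (denCoeff n d e β) =
        algebraMap (ShiftRing n d e k) _
          (C (denCoeff n d e β) +
            ∑ i, C (algebraMap _ (CoeffField n d e) (v i β)) * X i) := by
  -- The shifted denominator `q` still solves the Padé system of the Taylor coefficients `c`, and
  -- the numerator `p` is chosen so that `p / q` has these Taylor coefficients.
  let c : Mon n 0 m → ShiftRing n d e k := fun γ => C (ratCoeff n d e m γ)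
  let q : Mon n 1 e → ShiftRing n d e k := fun β => C (denCoeff n d e β) +
    ∑ i, C (algebraMap _ (CoeffField n d e) (v i β)) * X i
  let p : Mon n 1 d → ShiftRing n d e k := fun α => c ⟨α.1, Nat.zero_le _, hdm α⟩ +
    ∑ β : Mon n 1 e, shiftCoeff c α.1 β.1 * q β
  have hshift : ∀ α β, shiftCoeff c α β = C (shiftCoeff (ratCoeff n d e m) α β) := fun α β =>
    (map_shiftCoeff C (ratCoeff n d e m) α β).symm
  obtain ⟨hgen, hgen'⟩ := generic_equations (e := e) hdm
  have hcoeff : ∀ γ : Mon n 0 m, MvPowerSeries.coeff γ.1 (quotSeries p q) = c γ := by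
    refine (coeff_quotSeries_eq_iff hdm p q c ?_).2 ⟨fun α => ?_, fun α => rfl⟩
    · simp only [c, ratCoeff, taylorPoly_zero, map_one]
    · have h0 : ∀ i, ∑ β, shiftCoeff (ratCoeff n d e m) α.1 β.1 *
          algebraMap _ (CoeffField n d e) (v i β) = 0 := fun i => by
        have := congrArg (algebraMap _ (CoeffField n d e)) (congrFun (hv i) α)
        rw [Pi.zero_apply, map_zero, Matrix.mulVec, dotProduct, map_sum] at this
        simpa only [map_mul, algebraMap_genPadeMatrix] using this
      have h1 : ∑ β : Mon n 1 e, shiftCoeff c α.1 β.1 *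
          ∑ i, C (algebraMap _ (CoeffField n d e) (v i β)) * X i =
            (0 : ShiftRing n d e k) := by
        simp only [hshift, Finset.mul_sum, ← mul_assoc, ← map_mul]
        rw [Finset.sum_comm]
        refine Finset.sum_eq_zero fun i _ => ?_
        rw [← Finset.sum_mul, ← map_sum, h0, map_zero, zero_mul]
      simp only [q, mul_add, Finset.sum_add_distrib, h1, add_zero]
      simp only [hshift, ← map_mul, ← map_sum]
      rw [hgen α, map_neg]
  let Θ₀ : MvPolynomial (Mon n 1 d ⊕ Mon n 1 e) ℂ →+* ShiftRing n d e k :=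
    eval₂Hom ((C : CoeffField n d e →+* ShiftRing n d e k).comp
      (algebraMap ℂ (CoeffField n d e))) (Sum.elim p q)
  have hΘl : ∀ α, Θ₀ (X (Sum.inl α)) = p α := fun α => by simp [Θ₀]
  have hΘr : ∀ β, Θ₀ (X (Sum.inr β)) = q β := fun β => by simp [Θ₀]
  have hΘt : ∀ γ, Θ₀ (taylorPoly n d e m γ) = c γ := fun γ => by
    rw [map_taylorPoly, ← hcoeff]
    simp only [hΘl, hΘr]
  have hqc : ∀ β, constantCoeff (q β) = denCoeff n d e β := fun β => by
    simp [q]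
  -- The value of the shift at `X = 0` is the identity, so that it extends to the fraction field.
  have hcomp : (constantCoeff : ShiftRing n d e k →+* CoeffField n d e).comp Θ₀ =
      algebraMap _ (CoeffField n d e) := by
    refine MvPolynomial.ringHom_ext (fun a => ?_) (fun i => ?_)
    · simp only [RingHom.comp_apply, Θ₀, eval₂Hom_C, constantCoeff_C]
      rfl
    · rcases i with α | β
      · rw [RingHom.comp_apply, hΘl]
        change _ = numCoeff n d e α
        rw [hgen' α]
        simp only [p, map_add, map_sum, map_mul, hqc, hshift, c, constantCoeff_C]
      · rw [RingHom.comp_apply, hΘr, hqc]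
        rfl
  have hinj : Function.Injective
      ((algebraMap (ShiftRing n d e k) (FractionRing (ShiftRing n d e k))).comp Θ₀) := by
    rw [RingHom.coe_comp]
    refine (IsFractionRing.injective (ShiftRing n d e k) (FractionRing (ShiftRing n d e k))).comp ?_
    refine Function.Injective.of_comp
      (f := (constantCoeff : ShiftRing n d e k →+* CoeffField n d e)) ?_
    rw [← RingHom.coe_comp, hcomp]
    exact IsFractionRing.injective _ (CoeffField n d e)
  have hlift : ∀ f : CoeffRing n d e,
      IsFractionRing.lift hinj (algebraMap _ (CoeffField n d e) f) =
        algebraMap (ShiftRing n d e k) (FractionRing (ShiftRing n d e k)) (Θ₀ f) := fun f =>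
    IsFractionRing.lift_algebraMap hinj f
  refine ⟨IsFractionRing.lift hinj, fun a => ?_, fun β => ?_⟩
  · obtain ⟨a, ha⟩ := a
    change IsFractionRing.lift hinj a =
      algebraMap (ShiftRing n d e k) (FractionRing (ShiftRing n d e k)) (C a)
    induction ha using IntermediateField.adjoin_induction with
    | mem x hx =>
      obtain ⟨γ, rfl⟩ := hx
      rw [hlift, hΘt]
      rfl
    | algebraMap x =>
      rw [IsScalarTower.algebraMap_apply ℂ (CoeffRing n d e) (CoeffField n d e), hlift]
      congr 1
      simp only [Θ₀, MvPolynomial.algebraMap_eq, eval₂Hom_C]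
      rfl
    | add x y _ _ hx hy => simp only [map_add, hx, hy]
    | inv x _ hx =>
      rw [map_inv₀, hx]
      exact (map_inv₀ ((algebraMap (ShiftRing n d e k)
        (FractionRing (ShiftRing n d e k))).comp C) x).symm
    | mul x y _ _ hx hy => simp only [map_mul, hx, hy]
  · rw [denCoeff, hlift, hΘr]
    rfl

/-- The field generated by the Taylor coefficients has transcendence degree the number of
coefficients of the numerator plus the generic rank of the reduced Padé matrix. -/
theorem trdeg_genField_taylorPoly (hdm : ∀ α : Mon n 1 d, α.1.degree ≤ m) :
    (Algebra.trdeg ℂ (genField (taylorPoly n d e m))).toNat =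
      Fintype.card (Mon n 1 d) + (genPadeMatrix n d e m).rank := by
  have h1 : Algebra.trdeg (genField (taylorPoly n d e m)) (CoeffField n d e) =
      (Fintype.card (Mon n 1 e) - (genPadeMatrix n d e m).rank : ℕ) := by
    refine trdeg_eq_card_sub_rank (genPadeMatrix n d e m)
      (fun α => - genCoeff n d e m ⟨α.1, Nat.zero_le _, α.2.2⟩)
      (fun β => denCoeff n d e β) (fun α => ?_)
      (adjoin_denominator_eq_top hdm) (exists_shift hdm)
    simp only [algebraMap_genPadeMatrix]
    exact (generic_equations hdm).1 α
  have h2 := trdeg_intermediateField_add_eq (genField (taylorPoly n d e m))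
  rw [h1, trdeg_fractionRing_mvPolynomial] at h2
  have h3 := congrArg Cardinal.toNat h2
  rw [Cardinal.toNat_add trdeg_genField_lt_aleph0 Cardinal.natCast_lt_aleph0] at h3
  have h4 : (genPadeMatrix n d e m).rank ≤ Fintype.card (Mon n 1 e) :=
    Matrix.rank_le_card_width _
  simp at h3
  omega

end GenericRank

/-! ### The number of monomials -/

noncomputable section Counting

open MvPolynomial

theorem sum_range_multichoose (n d : ℕ) :
    ∑ k ∈ Finset.range (d + 1), Nat.multichoose n k = Nat.multichoose (n + 1) d := by
  induction d with
  | zero => simp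
  | succ d ih =>
    rw [Finset.sum_range_succ, ih, Nat.multichoose_succ_succ, add_comm]

/-- Stars and bars, degree by degree. -/
theorem card_mon (n d : ℕ) : Fintype.card (Mon n 1 d) = (d + n).choose n - 1 := by
  classical
  have h1 : Fintype.card (Mon n 1 d) = ∑ k ∈ Finset.range d, Nat.multichoose n (k + 1) := by
    rw [Fintype.card_of_subtype ((Finset.range d).biUnion fun k =>
      Finset.finsuppAntidiag (Finset.univ : Finset (Fin n)) (k + 1)), Finset.card_biUnion]
    · refine Finset.sum_congr rfl fun k _ => ?_
      rw [Finset.card_finsuppAntidiag_nat_eq_multichoose, Finset.card_univ, Fintype.card_fin]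
    · intro i _ j _ hij
      rw [Function.onFun, Finset.disjoint_left]
      intro f hf hf'
      rw [Finset.mem_finsuppAntidiag] at hf hf'
      have := hf.1.symm.trans hf'.1
      omega
    · intro f
      have hmem : ∀ k, f ∈ Finset.finsuppAntidiag (Finset.univ : Finset (Fin n)) (k + 1) ↔
          f.degree = k + 1 := fun k => by
        rw [Finset.mem_finsuppAntidiag, Finsupp.degree_eq_sum,
          and_iff_left (Finset.subset_univ _)]
      simp only [Finset.mem_biUnion, Finset.mem_range, hmem]
      constructor
      · rintro ⟨k, hk, h⟩
        omega
      · rintro ⟨h1, h2⟩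
        exact ⟨f.degree - 1, by omega, by omega⟩
  have h2 := sum_range_multichoose n d
  rw [Finset.sum_range_succ', ← h1, Nat.multichoose_zero_right, Nat.multichoose_eq] at h2
  have h3 : (n + 1 + d - 1).choose d = (d + n).choose n := by
    rw [show n + 1 + d - 1 = d + n by omega, Nat.choose_symm_add]
  omega

/-- If the expected dimension is smaller than the number of Taylor coefficients, then every
monomial of the numerator occurs among those of the Taylor polynomial. -/
theorem degree_le_of_choose_lt {n d m r : ℕ}
    (h : (d + n).choose n - 1 + r < (n + m).choose n) (α : Mon n 1 d) : α.1.degree ≤ m := by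
  by_contra! hm
  have hd : m + 1 ≤ d := (Nat.succ_le_of_lt hm).trans α.2.2
  -- Then some variable exists, and `choose (d + n) n` already exceeds `choose (n + m) n`.
  have hn : n ≠ 0 := by
    rintro rfl
    exact α.ne_zero (Subsingleton.elim _ _)
  obtain ⟨k, rfl⟩ := Nat.exists_eq_succ_of_ne_zero hn
  have h1 : (m + 1 + (k + 1)).choose (k + 1) ≤ (d + (k + 1)).choose (k + 1) :=
    Nat.choose_le_choose _ (by omega)
  have h2 : (m + 1 + (k + 1)).choose (k + 1) =
      (k + 1 + m).choose k + (k + 1 + m).choose (k + 1) := by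
    rw [show m + 1 + (k + 1) = (k + 1 + m) + 1 by omega, Nat.choose_succ_succ]
  have h3 : 0 < (k + 1 + m).choose k := Nat.choose_pos (by omega)
  simp only [Nat.succ_eq_add_one] at h
  omega

end Counting

/-! ### The rank of the Padé matrix -/

noncomputable section PadeRank

open MvPolynomial

variable {n d e m : ℕ}

theorem isHomogeneous_shiftCoeff_X (α β : Fin n →₀ ℕ) :
    (shiftCoeff (fun γ : Mon n 0 m => (X γ : MvPolynomial (Mon n 0 m) ℂ)) α β).IsHomogeneous 1 := by
  rw [shiftCoeff]
  split_ifs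
  · rw [MvPowerSeries.coeff_apply, polySeries]
    split_ifs
    · exact isHomogeneous_X _ _
    · exact isHomogeneous_zero _ _ _
  · exact isHomogeneous_zero _ _ _

/-- A minor of the Padé matrix, as a polynomial in the coefficients of the Taylor polynomial. -/
def minorPoly (m : ℕ) {k : ℕ} (f g : Fin k → Fin n →₀ ℕ) : MvPolynomial (Mon n 0 m) ℂ :=
  (Matrix.of fun i j => shiftCoeff X (f i) (g j)).det

theorem isHomogeneous_minorPoly {k : ℕ} (f g : Fin k → Fin n →₀ ℕ) :
    (minorPoly m f g).IsHomogeneous k := by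
  rw [minorPoly, Matrix.det_apply']
  refine IsHomogeneous.sum _ _ _ fun σ _ => ?_
  have h1 : (∏ i, Matrix.of (fun i j => shiftCoeff (m := m) X (f i) (g j)) (σ i) i :
      MvPolynomial (Mon n 0 m) ℂ).IsHomogeneous (∑ _i : Fin k, 1) :=
    IsHomogeneous.prod _ _ _ fun i _ => isHomogeneous_shiftCoeff_X _ _
  have h2 : ((Equiv.Perm.sign σ : ℤ) : MvPolynomial (Mon n 0 m) ℂ).IsHomogeneous 0 := by
    rw [← map_intCast (C : ℂ →+* MvPolynomial (Mon n 0 m) ℂ)]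
    exact isHomogeneous_C _ _
  have := h2.mul h1
  simpa using this

theorem map_minorPoly {B : Type} [CommRing B] {k : ℕ} (φ : MvPolynomial (Mon n 0 m) ℂ →+* B)
    (f g : Fin k → Fin n →₀ ℕ) :
    φ (minorPoly m f g) = (Matrix.of fun i j => shiftCoeff (fun γ => φ (X γ)) (f i) (g j)).det := by
  rw [minorPoly, RingHom.map_det]
  congr 1
  ext i j
  exact map_shiftCoeff φ _ _ _

theorem padeMatrix_apply (c : Mon n 0 m → ℂ) (α : Mon n (d + 1) m) (β : Mon n 0 e) :
    padeMatrix n d e m c α β = shiftCoeff c α.1 β.1 := by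
  rw [padeMatrix, shiftCoeff, Matrix.of_apply]
  split_ifs
  · rw [coeff_polySeries _ _ ((Finsupp.degree_mono tsub_le_self).trans α.2.2)]
  · rfl

theorem reducedPadeMatrix_apply (c : Mon n 0 m → ℂ) (α : Mon n (d + 1) m) (β : Mon n 1 e) :
    reducedPadeMatrix n d e m c α β = shiftCoeff c α.1 β.1 :=
  padeMatrix_apply c α _

theorem shiftCoeff_zero {B : Type} [CommRing B] (c : Mon n 0 m → B) (α : Fin n →₀ ℕ)
    (hα : α.degree ≤ m) : shiftCoeff c α 0 = c ⟨α, Nat.zero_le _, hα⟩ := by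
  rw [shiftCoeff, if_pos (zero_le), tsub_zero, coeff_polySeries _ _ hα]

theorem shiftCoeff_mul {B : Type} [CommRing B] (a : B) (c : Mon n 0 m → B) (α β : Fin n →₀ ℕ) :
    shiftCoeff (fun γ => a * c γ) α β = a * shiftCoeff c α β := by
  rw [shiftCoeff, shiftCoeff, mul_ite, mul_zero, MvPowerSeries.coeff_apply,
    MvPowerSeries.coeff_apply, polySeries, polySeries, mul_dite, mul_zero]

theorem reducedPadeMatrix_mul (a : ℂ) (c : Mon n 0 m → ℂ) :
    reducedPadeMatrix n d e m (fun γ => a * c γ) = a • reducedPadeMatrix n d e m c := by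
  ext α β
  rw [Matrix.smul_apply, reducedPadeMatrix_apply, reducedPadeMatrix_apply, shiftCoeff_mul,
    smul_eq_mul]

/-- The linear system for the denominator is solvable if and only if the first column does not
increase the rank of the reduced Padé matrix. -/
theorem rank_padeMatrix_le_iff (c : Mon n 0 m → ℂ) :
    (padeMatrix n d e m c).rank ≤ (reducedPadeMatrix n d e m c).rank ↔
      ∃ q : Mon n 1 e → ℂ, ∀ α : Mon n (d + 1) m,
        ∑ β, shiftCoeff c α.1 β.1 * q β = - c ⟨α.1, Nat.zero_le _, α.2.2⟩ := by
  have hsub : Submodule.span ℂ (Set.range (reducedPadeMatrix n d e m c).col) ≤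
      Submodule.span ℂ (Set.range (padeMatrix n d e m c).col) := by
    refine Submodule.span_mono ?_
    rintro _ ⟨β, rfl⟩
    exact ⟨⟨β.1, Nat.zero_le _, β.2.2⟩, rfl⟩
  have hcol : (padeMatrix n d e m c).col ⟨0, by simp⟩ =
      fun α => c ⟨α.1, Nat.zero_le _, α.2.2⟩ := by
    ext α
    exact (padeMatrix_apply (e := e) c α ⟨0, by simp⟩).trans (shiftCoeff_zero c α.1 α.2.2)
  rw [Matrix.rank_eq_finrank_span_cols, Matrix.rank_eq_finrank_span_cols]
  constructor
  · intro h
    have heq := Submodule.eq_of_le_of_finrank_le hsub h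
    have hmem : (padeMatrix n d e m c).col ⟨0, by simp⟩ ∈
        Submodule.span ℂ (Set.range (reducedPadeMatrix n d e m c).col) := by
      rw [heq]
      exact Submodule.subset_span ⟨_, rfl⟩
    obtain ⟨q, hq⟩ := (Submodule.mem_span_range_iff_exists_fun ℂ).1 hmem
    refine ⟨fun β => - q β, fun α => ?_⟩
    have := congrFun hq α
    rw [hcol] at this
    change _ = c _ at this
    change ∑ β, shiftCoeff c α.1 β.1 * - q β = _
    rw [← this, Finset.sum_apply, ← Finset.sum_neg_distrib]
    refine Finset.sum_congr rfl fun β _ => ?_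
    rw [Pi.smul_apply, Matrix.col_apply, reducedPadeMatrix_apply, smul_eq_mul]
    ring
  · rintro ⟨q, hq⟩
    refine Submodule.finrank_mono (Submodule.span_le.2 ?_)
    rintro _ ⟨⟨β, hβ⟩, rfl⟩
    rcases Nat.eq_zero_or_pos β.degree with h | h
    · obtain rfl : β = 0 := (Finsupp.degree_eq_zero_iff β).1 h
      rw [hcol]
      refine (Submodule.mem_span_range_iff_exists_fun ℂ).2 ⟨fun β => - q β, ?_⟩
      ext α
      rw [Finset.sum_apply, ← neg_inj, ← hq α, ← Finset.sum_neg_distrib]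
      refine Finset.sum_congr rfl fun β _ => ?_
      rw [Pi.smul_apply, Matrix.col_apply, reducedPadeMatrix_apply, smul_eq_mul]
      ring
    · exact Submodule.subset_span ⟨⟨β, h, hβ.2⟩, rfl⟩

end PadeRank

/-! ### Solution sets of linear systems -/

noncomputable section LinearSolutions

open MvPolynomial Topology

/-- The set of solutions of a consistent linear system, some further coordinates being determined
by the solution, is an affine space of the dimension of the kernel. -/
theorem topologicalKrullDim_solutions {κ τ ρ : Type} [Fintype τ] (A : Matrix ρ τ ℂ) (b : ρ → ℂ)
    (B : Matrix κ τ ℂ) (u : κ → ℂ) (q₀ : τ → ℂ) (hq₀ : ∀ a, ∑ j, A a j * q₀ j = b a) :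
    topologicalKrullDim {z : AffSpace (κ ⊕ τ) |
      (∀ a, ∑ j, A a j * z (Sum.inr j) = b a) ∧
        ∀ i, z (Sum.inl i) = u i + ∑ j, B i j * z (Sum.inr j)} =
      (Module.finrank ℂ (LinearMap.ker A.mulVecLin) : WithBot ℕ∞) := by
  classical
  set S := {z : AffSpace (κ ⊕ τ) |
      (∀ a, ∑ j, A a j * z (Sum.inr j) = b a) ∧
        ∀ i, z (Sum.inl i) = u i + ∑ j, B i j * z (Sum.inr j)}
  set k := Module.finrank ℂ (LinearMap.ker A.mulVecLin)
  -- The solutions are parametrized by the coordinates of the kernel; a linear left inverse `G` of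
  -- the parametrization of the kernel gives back these coordinates.
  let v := Module.finBasis ℂ (LinearMap.ker A.mulVecLin)
  obtain ⟨G, hG⟩ := LinearMap.exists_leftInverse_of_injective
    ((LinearMap.ker A.mulVecLin).subtype ∘ₗ v.equivFun.symm.toLinearMap)
    (LinearMap.ker_eq_bot.2 (Subtype.val_injective.comp v.equivFun.symm.injective))
  let tr : τ → MvPolynomial (Fin k) ℂ := fun j => C (q₀ j) + ∑ i, C ((v i).1 j) * X i
  let t : κ ⊕ τ → MvPolynomial (Fin k) ℂ :=
    Sum.elim (fun i => C (u i) + ∑ j, C (B i j) * tr j) tr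
  let g : Fin k → MvPolynomial (κ ⊕ τ) ℂ := fun i =>
    ∑ j, C (LinearMap.toMatrix' G i j) * (X (Sum.inr j) - C (q₀ j))
  have hv : ∀ (y : Fin k → ℂ) j, (v.equivFun.symm y).1 j = ∑ i, (v i).1 j * y i := fun y j => by
    simp [Module.Basis.equivFun_symm_apply, mul_comm]
  have hr : ∀ y j, polyMap t y (Sum.inr j) =
      q₀ j + (v.equivFun.symm (y : Fin k → ℂ)).1 j := fun y j => by
    refine Eq.trans ?_ (congrArg (q₀ j + ·) (hv y j).symm)
    simp [polyMap, t, tr]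
  have hl : ∀ y i, polyMap t y (Sum.inl i) =
      u i + ∑ j, B i j * polyMap t y (Sum.inr j) := fun y i => by
    simp [polyMap, t]
  have hg : ∀ z : AffSpace (κ ⊕ τ), polyMap g z = G fun j => z (Sum.inr j) - q₀ j := fun z => by
    conv_rhs => rw [← Matrix.toLin'_toMatrix' G, Matrix.toLin'_apply]
    ext i
    simp [polyMap, g, Matrix.mulVec, dotProduct]
  have hleft : Function.LeftInverse (polyMap g) (polyMap t) := fun y => by
    rw [hg]
    simp only [hr, add_sub_cancel_left]
    exact LinearMap.congr_fun hG (y : Fin k → ℂ)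
  have hrange : Set.range (polyMap t) = S := by
    ext z
    constructor
    · rintro ⟨y, rfl⟩
      refine ⟨fun a => ?_, fun i => hl y i⟩
      have h := congrFun (v.equivFun.symm (y : Fin k → ℂ)).2 a
      simp only [hr, mul_add, Finset.sum_add_distrib, hq₀]
      rw [add_eq_left]
      exact h
    · rintro ⟨h1, h2⟩
      have hw : (fun j => z (Sum.inr j) - q₀ j) ∈ LinearMap.ker A.mulVecLin := by
        rw [LinearMap.mem_ker]
        ext a
        change ∑ j, A a j * (z (Sum.inr j) - q₀ j) = 0
        simp only [mul_sub, Finset.sum_sub_distrib, hq₀, h1, sub_self]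
      have hz : ∀ j, polyMap t (v.equivFun ⟨_, hw⟩ : Fin k → ℂ) (Sum.inr j) =
          z (Sum.inr j) := fun j =>
        ((hr _ j).trans (congrArg (fun w => q₀ j + w.1 j)
          (v.equivFun.symm_apply_apply ⟨_, hw⟩))).trans (add_sub_cancel _ _)
      refine ⟨(v.equivFun ⟨_, hw⟩ : Fin k → ℂ), ?_⟩
      ext (i | j)
      · exact (hl _ i).trans ((congrArg (u i + ·) (Finset.sum_congr rfl fun j _ =>
          congrArg (B i j * ·) (hz j))).trans (h2 i).symm)
      · exact hz j
  have hemb := Function.LeftInverse.isEmbedding hleft (continuous_polyMap g)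
    (continuous_polyMap t)
  have hdim := IsHomeomorph.topologicalKrullDim_eq _ hemb.toHomeomorph.isHomeomorph
  rw [topologicalKrullDim_affSpace, Nat.card_fin, hrange] at hdim
  exact hdim.symm

end LinearSolutions

/-! ### Generic points of the Taylor variety and their fibers -/

noncomputable section GenericPoints

open MvPolynomial Topology

variable (n d e m : ℕ)

theorem polyMap_taylorPoly (z : AffSpace (Mon n 1 d ⊕ Mon n 1 e)) :
    polyMap (taylorPoly n d e m) z = taylorCoeff n m
      (normPoly n d fun α => z (Sum.inl α)) (normPoly n e fun β => z (Sum.inr β)) := by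
  ext γ
  rw [taylorCoeff_normPoly, polyMap, map_taylorPoly]
  simp only [evalAt_X]

theorem polyMap_taylorPoly_ne_zero (z : AffSpace (Mon n 1 d ⊕ Mon n 1 e)) :
    polyMap (taylorPoly n d e m) z ≠ 0 := by
  rw [polyMap_taylorPoly]
  exact taylorCoeff_ne_zero n m d e _ _

theorem taylorMap_eq_projMap :
    taylorMap n d e m = projMap (taylorPoly n d e m) (polyMap_taylorPoly_ne_zero n d e m) := by
  ext1 z
  simp only [projMap, polyMap_taylorPoly]
  rfl

theorem isIrreducible_taylorVariety : IsIrreducible (taylorVariety n d e m) := by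
  rw [taylorVariety, taylorMap_eq_projMap, ← Set.image_univ]
  exact (IrreducibleSpace.isIrreducible_univ _ |>.image _
    (continuous_projMap _ _).continuousOn).closure

/-- The affine cone over the Taylor variety. -/
def taylorCone : Set (AffSpace (Mon n 0 m)) :=
  {x | ∀ (f : MvPolynomial (Mon n 0 m) ℂ) (k : ℕ), f.IsHomogeneous k →
    aeval (taylorPoly n d e m) f = 0 → evalAt x f = 0}

variable {n d e m}

theorem hcoord_mem_taylorCone_iff (T : ProjSpace (Mon n 0 m)) :
    hcoord T ∈ taylorCone n d e m ↔ T ∈ taylorVariety n d e m := by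
  rw [taylorVariety, taylorMap_eq_projMap]
  conv_rhs => rw [← ofCoord_hcoord T]
  exact (ofCoord_mem_closure_range_projMap_iff _ _).symm

theorem polyMap_mem_taylorCone (z : AffSpace (Mon n 1 d ⊕ Mon n 1 e)) :
    polyMap (taylorPoly n d e m) z ∈ taylorCone n d e m := fun f k _ h => by
  rw [evalAt_polyMap, h, map_zero]

theorem evalAt_minorPoly {k : ℕ} (x : AffSpace (Mon n 0 m)) (f g : Fin k → Fin n →₀ ℕ) :
    evalAt x (minorPoly m f g) = (Matrix.of fun i j => shiftCoeff x (f i) (g j)).det := by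
  rw [map_minorPoly]
  simp only [evalAt_X]

/-- A minor of the reduced Padé matrix is nonzero as a function of numerator and denominator if
and only if it is nonzero for the generic matrix. -/
theorem aeval_minorPoly_ne_zero_iff {k : ℕ} (f : Fin k → Mon n (d + 1) m)
    (g : Fin k → Mon n 1 e) :
    aeval (taylorPoly n d e m) (minorPoly m (fun i => (f i).1) fun i => (g i).1) ≠ 0 ↔
      ((genPadeMatrix n d e m).submatrix f g).det ≠ 0 := by
  rw [← map_ne_zero_iff _ (IsFractionRing.injective (CoeffRing n d e) (CoeffField n d e)),
    ← map_ne_zero_iff _ (algebraMap (genField (taylorPoly n d e m)) (CoeffField n d e)).injective]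
  have h := map_minorPoly ((algebraMap (CoeffRing n d e) (CoeffField n d e)).comp
    (aeval (taylorPoly n d e m)).toRingHom) (fun i => (f i).1) fun i => (g i).1
  have h' : algebraMap (CoeffRing n d e) (CoeffField n d e) (aeval (taylorPoly n d e m)
      (minorPoly m (fun i => (f i).1) fun i => (g i).1)) =
      (algebraMap (genField (taylorPoly n d e m)) (CoeffField n d e))
        ((genPadeMatrix n d e m).submatrix f g).det := by
    refine h.trans ?_
    rw [RingHom.map_det]
    congr 1
    ext i j
    refine Eq.trans ?_ (algebraMap_genPadeMatrix _ _).symm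
    simp only [RingHom.comp_apply, AlgHom.toRingHom_eq_coe, RingHom.coe_coe, aeval_X]
    rfl
  rw [h']

/-- No point of the cone has a reduced Padé matrix of rank larger than the generic rank. -/
theorem rank_reducedPadeMatrix_le {x : AffSpace (Mon n 0 m)} (hx : x ∈ taylorCone n d e m) :
    (reducedPadeMatrix n d e m x).rank ≤ (genPadeMatrix n d e m).rank := by
  obtain ⟨f, g, hfg⟩ := exists_submatrix_det_ne_zero (reducedPadeMatrix n d e m x)
  refine le_rank_of_submatrix_det_ne_zero _ f g ((aeval_minorPoly_ne_zero_iff f g).1 fun h => ?_)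
  have h0 := hx _ _ (isHomogeneous_minorPoly _ _) h
  rw [evalAt_minorPoly] at h0
  refine hfg (Eq.trans ?_ h0)
  congr 1
  ext i j
  exact reducedPadeMatrix_apply _ _ _

/-- The first column does not increase the rank of the Padé matrix beyond the generic rank:
a nonzero minor of the Padé matrix at a point of the cone is nonzero at the coefficients of
the Taylor polynomial of some quotient, where the first column is a combination of the others. -/
theorem rank_padeMatrix_le (hdm : ∀ α : Mon n 1 d, α.1.degree ≤ m)
    {x : AffSpace (Mon n 0 m)} (hx : x ∈ taylorCone n d e m) :
    (padeMatrix n d e m x).rank ≤ (genPadeMatrix n d e m).rank := by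
  obtain ⟨f, g, hfg⟩ := exists_submatrix_det_ne_zero (padeMatrix n d e m x)
  have hF : ∀ y : AffSpace (Mon n 0 m),
      evalAt y (minorPoly m (fun i => (f i).1) fun i => (g i).1) =
        ((padeMatrix n d e m y).submatrix f g).det := fun y => by
    rw [evalAt_minorPoly]
    congr 1
    ext i j
    exact (padeMatrix_apply _ _ _).symm
  have hne : aeval (taylorPoly n d e m)
      (minorPoly m (fun i => (f i).1) fun i => (g i).1) ≠ 0 := fun h =>
    hfg ((hF x).symm.trans (hx _ _ (isHomogeneous_minorPoly _ _) h))
  obtain ⟨z, hz⟩ := exists_evalAt_ne_zero hne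
  rw [← evalAt_polyMap, hF] at hz
  refine (le_rank_of_submatrix_det_ne_zero _ f g hz).trans (le_trans ?_
    (rank_reducedPadeMatrix_le (polyMap_mem_taylorCone z)))
  refine (rank_padeMatrix_le_iff _).2 ⟨fun β => z (Sum.inr β), ?_⟩
  refine ((coeff_quotSeries_eq_iff hdm (fun α => z (Sum.inl α)) (fun β => z (Sum.inr β)) _
    ?_).1 fun γ => ?_).1
  · rw [polyMap, taylorPoly_zero, map_one]
  · rw [polyMap_taylorPoly, taylorCoeff_normPoly]

/-- A dense open subset of the Taylor variety on which the rank is generic and the constant term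
of the Taylor polynomial does not vanish. -/
theorem exists_isOpen_rank_eq (n d e m : ℕ) :
    ∃ U : Set (ProjSpace (Mon n 0 m)), IsOpen U ∧
      taylorVariety n d e m ⊆ closure (taylorVariety n d e m ∩ U) ∧
      ∀ T ∈ taylorVariety n d e m ∩ U, hcoord T ⟨0, by simp⟩ ≠ (0 : ℂ) ∧
        (reducedPadeMatrix n d e m (hcoord T)).rank = (genPadeMatrix n d e m).rank := by
  obtain ⟨f, g, hfg⟩ := exists_submatrix_det_ne_zero (genPadeMatrix n d e m)
  set F := minorPoly m (fun i => (f i).1) fun i => (g i).1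
  let X₀ : MvPolynomial (Mon n 0 m) ℂ := X ⟨0, by simp⟩
  have hhom : (X₀ * F).IsHomogeneous (1 + (genPadeMatrix n d e m).rank) :=
    (isHomogeneous_X _ _).mul (isHomogeneous_minorPoly _ _)
  refine ⟨{T | evalAt (hcoord T) (X₀ * F) ≠ 0}, isOpen_evalAt_hcoord_ne_zero hhom,
    subset_closure_inter_of_isPreirreducible_of_isOpen
      (isIrreducible_taylorVariety n d e m).isPreirreducible
      (isOpen_evalAt_hcoord_ne_zero hhom) ?_, ?_⟩
  · obtain ⟨z, hz⟩ := exists_evalAt_ne_zero ((aeval_minorPoly_ne_zero_iff f g).2 hfg)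
    refine ⟨taylorMap n d e m z, subset_closure ⟨z, rfl⟩, ?_⟩
    rw [taylorMap_eq_projMap]
    refine (evalAt_hcoord_ofCoord_ne_zero_iff hhom _ _).2 ?_
    rw [evalAt_polyMap, map_mul, map_mul, aeval_X, taylorPoly_zero, map_one, one_mul]
    exact hz
  · rintro T ⟨hT, hU⟩
    change evalAt (hcoord T) (X₀ * F) ≠ 0 at hU
    rw [map_mul, evalAt_X] at hU
    refine ⟨left_ne_zero_of_mul hU, le_antisymm
      (rank_reducedPadeMatrix_le ((hcoord_mem_taylorCone_iff T).2 hT)) ?_⟩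
    refine le_rank_of_submatrix_det_ne_zero _ f g fun h0 => right_ne_zero_of_mul hU ?_
    rw [evalAt_minorPoly]
    refine Eq.trans ?_ h0
    congr 1
    ext i j
    exact (reducedPadeMatrix_apply _ _ _).symm

/-- The fiber over `T` is given by the linear equations for numerator and denominator with the
coefficients `c` of `T`, scaled to have constant term `1`. -/
theorem taylorMap_eq_iff (hdm : ∀ α : Mon n 1 d, α.1.degree ≤ m) (T : ProjSpace (Mon n 0 m))
    (c : AffSpace (Mon n 0 m)) (a : ℂ) (hc : hcoord T = fun γ => a * c γ)
    (h0 : c ⟨0, by simp⟩ = (1 : ℂ)) (z : AffSpace (Mon n 1 d ⊕ Mon n 1 e)) :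
    taylorMap n d e m z = T ↔
      (∀ α : Mon n (d + 1) m, ∑ β : Mon n 1 e, shiftCoeff c α.1 β.1 * z (Sum.inr β) =
        - c ⟨α.1, Nat.zero_le _, α.2.2⟩) ∧
      ∀ α : Mon n 1 d, z (Sum.inl α) = c ⟨α.1, Nat.zero_le _, hdm α⟩ +
        ∑ β : Mon n 1 e, shiftCoeff c α.1 β.1 * z (Sum.inr β) := by
  have ha : a ≠ 0 := by
    rintro rfl
    exact hcoord_ne_zero T (hc.trans (AffSpace.ext fun γ => zero_mul _))
  have h1 : taylorMap n d e m z = T ↔ polyMap (taylorPoly n d e m) z = c := by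
    rw [taylorMap_eq_projMap]
    conv_lhs => rw [← ofCoord_hcoord T]
    rw [projMap, ofCoord_eq_iff]
    constructor
    · rintro ⟨b, hb⟩
      have hb0 := congrFun hb ⟨0, by simp⟩
      rw [polyMap, taylorPoly_zero, map_one, hc] at hb0
      change 1 = b * (a * c _) at hb0
      rw [h0, mul_one] at hb0
      rw [hb, hc]
      ext γ
      rw [← mul_assoc, ← hb0, one_mul]
    · rintro h
      refine ⟨a⁻¹, ?_⟩
      rw [h, hc]
      ext γ
      exact (inv_mul_cancel_left₀ ha _).symm
  rw [h1, polyMap_taylorPoly]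
  refine Iff.trans ?_ (coeff_quotSeries_eq_iff hdm (fun α => z (Sum.inl α))
    (fun β => z (Sum.inr β)) c h0)
  simp only [← taylorCoeff_normPoly]
  exact funext_iff

/-- Where the rank is generic, the linear system of the fiber is consistent. -/
theorem topologicalKrullDim_fiber (hdm : ∀ α : Mon n 1 d, α.1.degree ≤ m)
    {T : ProjSpace (Mon n 0 m)} (hT : T ∈ taylorVariety n d e m)
    (h0 : hcoord T ⟨0, by simp⟩ ≠ (0 : ℂ))
    (hr : (reducedPadeMatrix n d e m (hcoord T)).rank = (genPadeMatrix n d e m).rank) :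
    topologicalKrullDim (taylorMap n d e m ⁻¹' {T}) =
      (Module.finrank ℂ
        (LinearMap.ker (reducedPadeMatrix n d e m (hcoord T)).mulVecLin) : WithBot ℕ∞) := by
  set a : ℂ := hcoord T ⟨0, by simp⟩
  let c : AffSpace (Mon n 0 m) := fun γ => a⁻¹ * hcoord T γ
  have hc : hcoord T = fun γ => a * c γ :=
    AffSpace.ext fun γ => (mul_inv_cancel_left₀ h0 _).symm
  obtain ⟨q, hq⟩ := (rank_padeMatrix_le_iff (hcoord T)).1
    ((rank_padeMatrix_le hdm ((hcoord_mem_taylorCone_iff T).2 hT)).trans hr.ge)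
  have hker : LinearMap.ker (reducedPadeMatrix n d e m (hcoord T)).mulVecLin =
      LinearMap.ker (reducedPadeMatrix n d e m c).mulVecLin := by
    rw [hc]
    refine (congrArg (fun M => LinearMap.ker (Matrix.mulVecLin M))
      (reducedPadeMatrix_mul a c)).trans ?_
    ext w
    simp [h0]
  have hA : reducedPadeMatrix n d e m c = Matrix.of fun α β => shiftCoeff c α.1 β.1 := by
    ext α β
    exact reducedPadeMatrix_apply c α β
  rw [hker, hA, ← topologicalKrullDim_solutions _ (fun α => - c ⟨α.1, Nat.zero_le _, α.2.2⟩)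
    (Matrix.of fun (α : Mon n 1 d) (β : Mon n 1 e) => shiftCoeff c α.1 β.1)
    (fun α => c ⟨α.1, Nat.zero_le _, hdm α⟩) q fun α => ?_]
  · exact congrArg (fun S : Set _ => topologicalKrullDim S)
      (Set.ext fun z => taylorMap_eq_iff hdm T c a hc (inv_mul_cancel₀ h0) z)
  · change ∑ β : Mon n 1 e, shiftCoeff (fun γ => a⁻¹ * hcoord T γ) α.1 β.1 * q β =
      - (a⁻¹ * hcoord T _)
    refine (Finset.sum_congr rfl fun β _ => (congrArg (· * q β)
      (shiftCoeff_mul a⁻¹ (hcoord T) α.1 β.1)).trans (mul_assoc _ _ _)).trans ?_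
    rw [← Finset.mul_sum, ← mul_neg]
    exact congrArg (a⁻¹ * ·) (hq α)

/-- The dimension of the Taylor variety is the transcendence degree of the field generated by the
Taylor coefficients. -/
theorem topologicalKrullDim_taylorVariety (hdm : ∀ α : Mon n 1 d, α.1.degree ≤ m) :
    topologicalKrullDim (taylorVariety n d e m) =
      (((d + n).choose n - 1 + (genPadeMatrix n d e m).rank : ℕ) : WithBot ℕ∞) := by
  rw [taylorVariety, taylorMap_eq_projMap,
    topologicalKrullDim_closure_range_projMap (i₀ := ⟨0, by simp⟩) taylorPoly_zero,
    trdeg_genField_taylorPoly hdm, card_mon]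

end GenericPoints

end TaylorVar

theorem theorem5p1 (n d e m : ℕ) :
    ∃ r : ℕ,
      TaylorVar.Generically (TaylorVar.taylorVariety n d e m)
        (fun T => (TaylorVar.reducedPadeMatrix n d e m T.rep).rank = r) ∧
      ((d + n).choose n - 1 + r < (n + m).choose n →
        topologicalKrullDim (TaylorVar.taylorVariety n d e m)
            = (((d + n).choose n - 1 + r : ℕ) : WithBot ℕ∞) ∧
        TaylorVar.Generically (TaylorVar.taylorVariety n d e m)
          (fun T => topologicalKrullDim (TaylorVar.taylorMap n d e m ⁻¹' {T})
            = ((Module.finrank ℂ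
                (LinearMap.ker (TaylorVar.reducedPadeMatrix n d e m T.rep).mulVecLin) : ℕ) :
                WithBot ℕ∞))) := by
  obtain ⟨U, hU, hdense, hrank⟩ := TaylorVar.exists_isOpen_rank_eq n d e m
  refine ⟨(TaylorVar.genPadeMatrix n d e m).rank, ⟨U, hU, hdense, fun T hT => (hrank T hT).2⟩,
    fun hlt => ?_⟩
  have hdm := TaylorVar.degree_le_of_choose_lt hlt
  exact ⟨TaylorVar.topologicalKrullDim_taylorVariety hdm, U, hU, hdense, fun T hT =>
    TaylorVar.topologicalKrullDim_fiber hdm hT.1 (hrank T hT).1 (hrank T hT).2⟩
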